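/- Let $n\ge 1$, $0\le k\le n$ and $a,b,c\ge 0$ be integers. A \emph{permutation tableau} with $k$ rows and $n-k$ columns is a partition $\lambda=(\lambda_1\ge\dots\ge\lambda_k\ge 0)$ with $\lambda_1\le n-k$ (if $k\ge1$), together with a filling of the boxes of its left-justified Young diagram (placed in the top-left corner of the $k\times(n-k)$ rectangle, with $\lambda_i$ boxes in row $i$) by $0$'s and $1$'s such that each of the $n-k$ columns of the rectangle contains at least one $1$, and no $0$ has both a $1$ above it in the same column and a $1$ to its left in the same row. Every box of the rectangle outside the Young diagram is filled with a $2$. Let $T(k,a,b,c)$ be the set of permutation tableaux with $k$ rows and $n-k$ columns that contain precisely $a$ $0$'s, $b$ $1$'s and $c$ $2$'s. For a permutation $\pi=a_1a_2\cdots a_n\in\mathcal S_n$ let $\mathrm{des}\,\pi$ be the number of $i$ with $1\le i<n$ and $a_i>a_{i+1}$. For a pattern $p$ of three letters with one dash, such as $31\text{-}2$ or $2\text{-}31$, let $(p)\pi$ be the number of subsequences $a_{i_1}a_{i_2}a_{i_3}$ ($i_1<i_2<i_3$) of $\pi$ whose letters are in the same relative order as those of $p$ and in which the two letters corresponding to the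 letters of $p$ not separated by a dash are adjacent in $\pi$. Let $P(k,a,b,c)$ be the set of all $\pi\in\mathcal S_n$ such that $$k-1=\mathrm{des}\,\pi,$$ $$a=(31\text{-}2)\pi+(21\text{-}3)\pi+(3\text{-}21)\pi-\binom{\mathrm{des}\,\pi}{2},$$ $$b=(2\text{-}31)\pi+n-1-\mathrm{des}\,\pi,$$ $$c=(1\text{-}32)\pi+(32\text{-}1)\pi-\binom{\mathrm{des}\,\pi}{2}.$$ Then $|T(k,a,b,c)|=|P(k,a,b,c)|$. -/

import Mathlib

/-- A `k × m` array with entries in `{0, 1, 2}` is a permutation tableau if its entries other than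
`2` fill exactly the boxes of the Young diagram of a partition `lam` (top-left justified, `lam i`
boxes in row `i`, zero parts allowed), every column contains a `1`, and no `0` has both a `1` above
it in its column and a `1` to its left in its row. Row `0` is the top row. -/
structure IsPermutationTableau {k m : ℕ} (T : Matrix (Fin k) (Fin m) (Fin 3)) : Prop where
  /-- The boxes not filled with `2` form a Young diagram contained in the `k × m` rectangle. -/
  exists_shape : ∃ lam : Fin k → ℕ, Antitone lam ∧ (∀ i, lam i ≤ m) ∧
    ∀ i j, T i j ≠ 2 ↔ (j : ℕ) < lam i
  /-- Each column of the rectangle contains at least one `1`. -/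
  exists_one : ∀ j, ∃ i, T i j = 1
  /-- No `0` has a `1` above it in its column and a `1` to its left in its row. -/
  zero_cond : ∀ i j, T i j = 0 → ¬ ((∃ i' < i, T i' j = 1) ∧ ∃ j' < j, T i j' = 1)

/-- The number of boxes of the array `T` that are filled with the entry `e`. -/
noncomputable def entryCount {k m : ℕ} (T : Matrix (Fin k) (Fin m) (Fin 3)) (e : Fin 3) : ℕ :=
  {x : Fin k × Fin m | T x.1 x.2 = e}.ncard

/-- The permutation tableaux with `k` rows and `m` columns filled with precisely
`a` `0`'s, `b` `1`'s and `c` `2`'s. -/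
def permutationTableaux (k m a b c : ℕ) : Set (Matrix (Fin k) (Fin m) (Fin 3)) :=
  {T | IsPermutationTableau T ∧ entryCount T 0 = a ∧ entryCount T 1 = b ∧ entryCount T 2 = c}

/-- The number of descents of the permutation `π`: positions `i` with `π (i + 1) < π i`. -/
noncomputable def des {n : ℕ} (π : Equiv.Perm (Fin n)) : ℕ :=
  {i : Fin n | ∃ h : (i : ℕ) + 1 < n, π ⟨(i : ℕ) + 1, h⟩ < π i}.ncard

/-- `IsOccurrence p A π f`: the positions `f 0 < f 1 < ⋯` form an occurrence in `π` of the
generalized pattern with letters `p 0, p 1, …`, in which a dash is missing between the letters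
`p x` and `p (x + 1)` precisely for `x ∈ A`. -/
def IsOccurrence {l n : ℕ} (p : Fin l → ℕ) (A : Set ℕ) (π : Equiv.Perm (Fin n))
    (f : Fin l → Fin n) : Prop :=
  StrictMono f ∧ (∀ x y, π (f x) < π (f y) ↔ p x < p y) ∧
    ∀ x y : Fin l, (x : ℕ) ∈ A → (y : ℕ) = x + 1 → (f y : ℕ) = f x + 1

/-- The number of occurrences of a generalized pattern in `π`. -/
noncomputable def patternCount {l n : ℕ} (p : Fin l → ℕ) (A : Set ℕ)
    (π : Equiv.Perm (Fin n)) : ℕ :=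
  {f : Fin l → Fin n | IsOccurrence p A π f}.ncard

/-- The pattern (31-2). -/
noncomputable def pat31_2 {n : ℕ} (π : Equiv.Perm (Fin n)) : ℕ := patternCount ![3, 1, 2] {0} π

/-- The pattern (21-3). -/
noncomputable def pat21_3 {n : ℕ} (π : Equiv.Perm (Fin n)) : ℕ := patternCount ![2, 1, 3] {0} π

/-- The pattern (3-21). -/
noncomputable def pat3_21 {n : ℕ} (π : Equiv.Perm (Fin n)) : ℕ := patternCount ![3, 2, 1] {1} π

/-- The pattern (2-31). -/
noncomputable def pat2_31 {n : ℕ} (π : Equiv.Perm (Fin n)) : ℕ := patternCount ![2, 3, 1] {1} π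

/-- The pattern (1-32). -/
noncomputable def pat1_32 {n : ℕ} (π : Equiv.Perm (Fin n)) : ℕ := patternCount ![1, 3, 2] {1} π

/-- The pattern (32-1). -/
noncomputable def pat32_1 {n : ℕ} (π : Equiv.Perm (Fin n)) : ℕ := patternCount ![3, 2, 1] {0} π

/-- The permutations `π` of `n` letters with `des π = k - 1` and prescribed values `a`, `b`, `c` of
the three pattern statistics; all equations are between integers. -/
def patternPermutations (n k a b c : ℕ) : Set (Equiv.Perm (Fin n)) :=
  {π | (k : ℤ) - 1 = des π ∧
    (a : ℤ) = ((pat31_2 π : ℤ) + pat21_3 π + pat3_21 π) - (des π).choose 2 ∧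
    (b : ℤ) = (pat2_31 π : ℤ) + n - 1 - des π ∧
    (c : ℤ) = ((pat1_32 π : ℤ) + pat32_1 π) - (des π).choose 2}

/-! Both sides are refined by a lattice path: a word with `k - 1` letters `true` and `n - k` letters
`false`, whose head is the last step. For a tableau the path describes the shape: starting from one
row, `true` adds an empty row at the bottom and `false` adds, on the left, a column meeting all rows
present. The initial row 0 is always full, because the rightmost column contains a `1`. For a
permutation the path records which of the letters other than the largest are descent bottoms.

On both sides `c` is the same statistic `twos` of the path, and `a + b + c = k (n - k)`: for
permutations, every descent forms one of the six patterns with each of the `n - 2` other letters. So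
it suffices to show, path by path, that the number of `1`'s of a filling is distributed like `(2-31)
+ (n - k)`.

Fillings: a corner box contains either a `0`, which forces its whole row to be `0`, or a `1` that is
alone in its column, or a `1` that is not. Deleting the row, the column or the box gives a
three-term recurrence (`fillingGF_corner`).

Permutations: inserting the letters in increasing order gives a Laguerre history in which a letter
has as weight the number of its `2-31` occurrences in the role of `2`. The transfer operators `D`
(letter `true`) and `E` (letter `false`) of histories satisfy `ED = X DE + D + E`, the left factor
being the last step (`histGF_append_swap`). This is the same recurrence, so the two generating
functions agree up to a factor `X` for each column (`fillingGF_boxes`). The passage to histories is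
injective because the relative order of the letters can be rebuilt step by step (`eq_of_code_eq`),
and it is bijective because there are exactly `n!` histories (`sum_card_histories`). -/

namespace PermutationTableau

open Finset Polynomial

/-! ### Laguerre histories along a word and their commutation relation -/

/-- The `q`-analogue `1 + X + ⋯ + X ^ (h - 1)` of `h`. -/
noncomputable def qNum (h : ℕ) : ℕ[X] := ∑ i ∈ range h, X ^ i

theorem qNum_zero : qNum 0 = 0 := by simp [qNum]

theorem qNum_one : qNum 1 = 1 := by simp [qNum]

theorem qNum_succ (h : ℕ) : qNum (h + 1) = 1 + X * qNum h := by
  simp only [qNum]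
  rw [sum_range_succ', mul_sum, add_comm]
  simp [pow_succ']

/-- The words obtained from those in `A` by adding a letter `(top, r)` with `r < c` in front. -/
def extend (top : Bool) (c : ℕ) (A : Finset (List (Bool × ℕ))) : Finset (List (Bool × ℕ)) :=
  (range c ×ˢ A).image fun x => (top, x.1) :: x.2

/-- The Laguerre histories of height `h` whose steps raising the number of blocks are prescribed by
the letters `true` of a word. The head of a list is the last step of the history. -/
def histories : List Bool → ℕ → Finset (List (Bool × ℕ))
  | [], h => if h = 0 then {[]} else ∅
  | true :: w, h => extend false h (histories w (h - 1)) ∪ extend true h (histories w h)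
  | false :: w, h =>
      extend false (h + 1) (histories w h) ∪ extend true (h + 1) (histories w (h + 1))

/-- The sum of the weights of the steps of a history. -/
def weight (l : List (Bool × ℕ)) : ℕ := (l.map Prod.snd).sum

/-- The generating function by weight of the histories of height `h` along a word. -/
noncomputable def histGF (w : List Bool) (h : ℕ) : ℕ[X] := ∑ l ∈ histories w h, X ^ weight l

theorem cons_injective (top : Bool) :
    Function.Injective fun x : ℕ × List (Bool × ℕ) => (top, x.1) :: x.2 := by
  rintro ⟨a, l⟩ ⟨b, m⟩ h
  simpa using h

theorem mem_extend {top t : Bool} {c r : ℕ} {A : Finset (List (Bool × ℕ))}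
    {l : List (Bool × ℕ)} : (t, r) :: l ∈ extend top c A ↔ t = top ∧ r < c ∧ l ∈ A := by
  simp only [extend, mem_image, mem_product, mem_range, Prod.exists, List.cons.injEq,
    Prod.mk.injEq]
  constructor
  · rintro ⟨a, b, ⟨h1, h2⟩, ⟨rfl, rfl⟩, rfl⟩
    exact ⟨rfl, h1, h2⟩
  · rintro ⟨rfl, h1, h2⟩
    exact ⟨r, l, ⟨h1, h2⟩, ⟨rfl, rfl⟩, rfl⟩

theorem card_extend (top : Bool) (c : ℕ) (A : Finset (List (Bool × ℕ))) :
    #(extend top c A) = c * #A := by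
  rw [extend, card_image_of_injective _ (cons_injective top), card_product, card_range]

theorem disjoint_extend (c d : ℕ) (A B : Finset (List (Bool × ℕ))) :
    Disjoint (extend false c A) (extend true d B) := by
  rw [Finset.disjoint_left]
  intro l h1 h2
  simp only [extend, mem_image] at h1 h2
  obtain ⟨x, -, rfl⟩ := h1
  obtain ⟨y, -, h⟩ := h2
  simp at h

theorem sum_extend (top : Bool) (c : ℕ) (A : Finset (List (Bool × ℕ))) :
    ∑ l ∈ extend top c A, (X : ℕ[X]) ^ weight l = qNum c * ∑ l ∈ A, X ^ weight l := by
  rw [extend, sum_image (cons_injective top).injOn, sum_product, qNum, sum_mul_sum]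
  simp [weight, pow_add]

theorem histGF_nil (h : ℕ) : histGF [] h = if h = 0 then 1 else 0 := by
  unfold histGF histories
  split_ifs <;> simp [weight]

theorem histGF_true (w : List Bool) (h : ℕ) :
    histGF (true :: w) h = qNum h * (histGF w (h - 1) + histGF w h) := by
  rw [histGF, histories, sum_union (disjoint_extend ..), sum_extend, sum_extend, ← mul_add]
  rfl

theorem histGF_false (w : List Bool) (h : ℕ) :
    histGF (false :: w) h = qNum (h + 1) * (histGF w h + histGF w (h + 1)) := by
  rw [histGF, histories, sum_union (disjoint_extend ..), sum_extend, sum_extend, ← mul_add]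
  rfl

/-- The relation holds at the head of the word because `qNum (h + 1) = 1 + X * qNum h`; further
steps `v` act linearly and preserve it. -/
theorem histGF_append_swap (v u : List Bool) (h : ℕ) :
    histGF (v ++ false :: true :: u) h = X * histGF (v ++ true :: false :: u) h +
      histGF (v ++ true :: u) h + histGF (v ++ false :: u) h := by
  induction v generalizing h with
  | nil =>
    simp only [List.nil_append]
    rcases h with _ | h
    -- At height 0 the truncated index `h - 1` is harmless, since its term is multiplied by `qNum 0
    -- = 0`.
    · simp only [histGF_true, histGF_false, qNum_zero, qNum_succ]
      ring
    · simp only [histGF_true, histGF_false, Nat.add_sub_cancel]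
      rw [qNum_succ (h + 1)]
      ring
  | cons x v ih =>
    cases x
    · simp only [List.cons_append, histGF_false, ih]
      ring
    · simp only [List.cons_append, histGF_true, ih]
      ring

/-- The generating function of the histories that end with a step to height `0` after a word. -/
noncomputable def wordGF (w : List Bool) : ℕ[X] := histGF w 0 + histGF w 1

theorem histGF_false_zero (w : List Bool) : histGF (false :: w) 0 = wordGF w := by
  rw [histGF_false, zero_add, qNum_one, one_mul, wordGF]

theorem wordGF_append_swap (v u : List Bool) :
    wordGF (v ++ false :: true :: u) = X * wordGF (v ++ true :: false :: u) +
      wordGF (v ++ true :: u) + wordGF (v ++ false :: u) := by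
  simp only [wordGF, histGF_append_swap]
  ring

theorem wordGF_true (w : List Bool) : wordGF (true :: w) = wordGF w := by
  simp [wordGF, histGF_true, qNum_zero, qNum_one]

theorem histGF_replicate_false (a h : ℕ) :
    histGF (List.replicate a false) h = if h = 0 then 1 else 0 := by
  induction a generalizing h with
  | zero => exact histGF_nil h
  | succ a ih =>
    rw [List.replicate_succ, histGF_false, ih, ih]
    by_cases h0 : h = 0 <;> simp [h0, qNum_one]

theorem wordGF_sorted (b a : ℕ) :
    wordGF (List.replicate b true ++ List.replicate a false) = 1 := by
  induction b with
  | zero => simp [wordGF, histGF_replicate_false]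
  | succ b ih => rw [List.replicate_succ, List.cons_append, wordGF_true, ih]

/-! ### The total number of histories -/

/-- The words of length `n` in two letters. -/
def words : ℕ → Finset (List Bool)
  | 0 => {[]}
  | n + 1 => (words n).image (List.cons true) ∪ (words n).image (List.cons false)

theorem mem_words {n : ℕ} {w : List Bool} : w ∈ words n ↔ w.length = n := by
  induction n generalizing w with
  | zero => simp [words]
  | succ n ih =>
    rcases w with _ | ⟨x, w⟩
    · simp [words]
    · cases x <;> simp [words, ih]

theorem sum_words_succ (n : ℕ) (f : List Bool → ℕ) :
    ∑ w ∈ words (n + 1), f w = ∑ w ∈ words n, f (true :: w) + ∑ w ∈ words n, f (false :: w) := by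
  rw [words, sum_union, sum_image (List.cons_injective).injOn,
    sum_image (List.cons_injective).injOn]
  rw [Finset.disjoint_left]
  intro l h1 h2
  simp only [mem_image] at h1 h2
  obtain ⟨x, -, rfl⟩ := h1
  obtain ⟨y, -, h⟩ := h2
  simp at h

theorem card_histories_true (w : List Bool) (h : ℕ) :
    #(histories (true :: w) h) = h * #(histories w (h - 1)) + h * #(histories w h) := by
  rw [histories, card_union_of_disjoint (disjoint_extend ..), card_extend, card_extend]

theorem card_histories_false (w : List Bool) (h : ℕ) :
    #(histories (false :: w) h) =
      (h + 1) * #(histories w h) + (h + 1) * #(histories w (h + 1)) := by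
  rw [histories, card_union_of_disjoint (disjoint_extend ..), card_extend, card_extend]

/-- Only `h = 0` is needed, where the total is `n!`; the value at every height is what makes the
induction close. -/
theorem sum_card_histories (n h : ℕ) :
    ∑ w ∈ words n, #(histories w h) = n.factorial * n.choose h := by
  induction n generalizing h with
  | zero =>
    rcases h with _ | h <;> simp [words, histories]
  | succ n ih =>
    rw [sum_words_succ]
    simp only [card_histories_true, card_histories_false, sum_add_distrib, ← mul_sum, ih]
    rw [Nat.factorial_succ]
    rcases h with _ | h
    · have e1 : n.choose 1 = n := Nat.choose_one_right n
      simp [e1]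
      ring
    · rw [Nat.add_sub_cancel]
      have e2 := Nat.add_one_mul_choose_eq n h
      have e3 := Nat.add_one_mul_choose_eq n (h + 1)
      have e4 := Nat.choose_succ_succ n h
      have e5 := Nat.choose_succ_succ n (h + 1)
      simp only [Nat.succ_eq_add_one] at e4 e5
      have key : (h + 1) * n.choose h + (h + 1) * n.choose (h + 1) +
          ((h + 1 + 1) * n.choose (h + 1) + (h + 1 + 1) * n.choose (h + 1 + 1)) =
          (n + 1) * (n + 1).choose (h + 1) := by
        rw [e5] at e3
        rw [e4] at e2 ⊢
        linarith
      calc _ = n.factorial * ((h + 1) * n.choose h + (h + 1) * n.choose (h + 1) +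
          ((h + 1 + 1) * n.choose (h + 1) + (h + 1 + 1) * n.choose (h + 1 + 1))) := by ring
        _ = _ := by rw [key]; ring

/-! ### Fillings of a set of boxes and the corner recurrence -/

/-- Fillings by `0`'s and `1`'s of a set `B` of boxes with columns `C`, given as the set of boxes
containing a `1`. Rows are numbered from top to bottom, columns from right to left. -/
def IsFilling (C : Finset ℕ) (B O : Finset (ℕ × ℕ)) : Prop :=
  O ⊆ B ∧ (∀ j ∈ C, ∃ i, (i, j) ∈ O) ∧
    ∀ i j i' j', (i, j) ∈ B → i' < i → (i', j) ∈ O → j < j' → (i, j') ∈ O → (i, j) ∈ O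

open Classical in
/-- The finite set of all fillings in the sense of `IsFilling`. -/
noncomputable def fillings (C : Finset ℕ) (B : Finset (ℕ × ℕ)) : Finset (Finset (ℕ × ℕ)) :=
  {O ∈ B.powerset | IsFilling C B O}

theorem mem_fillings {C : Finset ℕ} {B O : Finset (ℕ × ℕ)} :
    O ∈ fillings C B ↔ IsFilling C B O := by
  simp only [fillings, mem_filter, mem_powerset, and_iff_right_iff_imp]
  exact fun h => h.1

/-- The generating function of fillings by number of `1`'s. -/
noncomputable def fillingGF (C : Finset ℕ) (B : Finset (ℕ × ℕ)) : ℕ[X] :=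
  ∑ O ∈ fillings C B, X ^ #O

/-- `(t, s)` is the last box of its row and of its column. -/
def IsCorner (B : Finset (ℕ × ℕ)) (t s : ℕ) : Prop :=
  (t, s) ∈ B ∧ (∀ i, (i, s) ∈ B → i ≤ t) ∧ ∀ j, (t, j) ∈ B → s ≤ j

/-- If the corner is `0`, its column has a `1`, necessarily above it. A `1` elsewhere in the row
would be to the left of the corner, which is forbidden; so the row is zero and imposes no condition
on the rest. -/
theorem isFilling_row_zero {C : Finset ℕ} {B O : Finset (ℕ × ℕ)} {t s : ℕ}
    (hc : IsCorner B t s) (hs : s ∈ C) :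
    (IsFilling C B O ∧ (t, s) ∉ O) ↔ IsFilling C {x ∈ B | x.1 ≠ t} O := by
  obtain ⟨hB, hcol, hrow⟩ := hc
  constructor
  · rintro ⟨⟨h1, h2, h3⟩, h4⟩
    have h5 : ∀ j, (t, j) ∉ O := by
      intro j hj
      have hsj : s < j := lt_of_le_of_ne (hrow j (h1 hj)) (by rintro rfl; exact h4 hj)
      obtain ⟨i, hi⟩ := h2 s hs
      have hit : i < t := lt_of_le_of_ne (hcol i (h1 hi)) (by rintro rfl; exact h4 hi)
      exact h4 (h3 t s i j hB hit hi hsj hj)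
    refine ⟨?_, h2, fun i j i' j' hb => h3 i j i' j' (mem_filter.1 hb).1⟩
    rintro ⟨i, j⟩ hx
    refine mem_filter.2 ⟨h1 hx, ?_⟩
    rintro rfl
    exact h5 j hx
  · rintro ⟨h1, h2, h3⟩
    have h5 : ∀ j, (t, j) ∉ O := fun j hj => by simpa using (mem_filter.1 (h1 hj)).2
    refine ⟨⟨fun x hx => (mem_filter.1 (h1 hx)).1, h2, ?_⟩, h5 s⟩
    intro i j i' j' hb hi hO hj hO'
    refine h3 i j i' j' (mem_filter.2 ⟨hb, ?_⟩) hi hO hj hO'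
    rintro rfl
    exact h5 j' hO'

/-- A `1` in the corner has no box below it or to its right, so it restricts no other box. If it is
the only `1` of its column, the column can be dropped. -/
theorem isFilling_insert_column {C : Finset ℕ} {B O : Finset (ℕ × ℕ)} {t s : ℕ}
    (hc : IsCorner B t s) (hO : (t, s) ∉ O) :
    (IsFilling C B (insert (t, s) O) ∧ ¬ ∃ i, (i, s) ∈ O) ↔
      IsFilling (C.erase s) {x ∈ B | x.2 ≠ s} O := by
  obtain ⟨hB, hcol, hrow⟩ := hc
  constructor
  · rintro ⟨⟨h1, h2, h3⟩, h4⟩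
    refine ⟨?_, ?_, ?_⟩
    · rintro ⟨i, j⟩ hx
      refine mem_filter.2 ⟨h1 (mem_insert_of_mem hx), ?_⟩
      rintro rfl
      exact h4 ⟨i, hx⟩
    · intro j hj
      rw [mem_erase] at hj
      obtain ⟨i, hi⟩ := h2 j hj.2
      rw [mem_insert] at hi
      rcases hi with hi | hi
      · simp only [Prod.mk.injEq] at hi
        exact absurd hi.2 hj.1
      · exact ⟨i, hi⟩
    · intro i j i' j' hb hi ho hj ho'
      rw [mem_filter] at hb
      have := h3 i j i' j' hb.1 hi (mem_insert_of_mem ho) hj (mem_insert_of_mem ho')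
      rw [mem_insert] at this
      rcases this with h | h
      · simp only [Prod.mk.injEq] at h
        exact absurd h.2 hb.2
      · exact h
  · rintro ⟨h1, h2, h3⟩
    have h4 : ∀ i, (i, s) ∉ O := fun i hi => by simpa using (mem_filter.1 (h1 hi)).2
    refine ⟨⟨?_, ?_, ?_⟩, fun ⟨i, hi⟩ => h4 i hi⟩
    · intro x hx
      rw [mem_insert] at hx
      rcases hx with rfl | hx
      · exact hB
      · exact (mem_filter.1 (h1 hx)).1
    · intro j hj
      by_cases hjs : j = s
      · exact ⟨t, by simp [hjs]⟩
      · obtain ⟨i, hi⟩ := h2 j (mem_erase.2 ⟨hjs, hj⟩)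
        exact ⟨i, mem_insert_of_mem hi⟩
    · intro i j i' j' hb hi ho hj ho'
      simp only [mem_insert, Prod.mk.injEq] at ho ho' ⊢
      rcases ho with ⟨rfl, rfl⟩ | ho
      · exact absurd (hcol i hb) (by omega)
      · rcases ho' with ⟨rfl, rfl⟩ | ho'
        · exact absurd (hrow j hb) (by omega)
        · refine Or.inr (h3 i j i' j' (mem_filter.2 ⟨hb, ?_⟩) hi ho hj ho')
          rintro rfl
          exact h4 i' ho

/-- When the column has another `1`, the corner is not needed to satisfy the column condition, so
only the box disappears. -/
theorem isFilling_insert_erase {C : Finset ℕ} {B O : Finset (ℕ × ℕ)} {t s : ℕ}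
    (hc : IsCorner B t s) (hs : s ∈ C) (hO : (t, s) ∉ O) :
    (IsFilling C B (insert (t, s) O) ∧ ∃ i, (i, s) ∈ O) ↔ IsFilling C (B.erase (t, s)) O := by
  obtain ⟨hB, hcol, hrow⟩ := hc
  constructor
  · rintro ⟨⟨h1, h2, h3⟩, h4⟩
    refine ⟨?_, ?_, ?_⟩
    · intro x hx
      refine mem_erase.2 ⟨?_, h1 (mem_insert_of_mem hx)⟩
      rintro rfl
      exact hO hx
    · intro j hj
      by_cases hjs : j = s
      · subst hjs
        exact h4
      · obtain ⟨i, hi⟩ := h2 j hj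
        simp only [mem_insert, Prod.mk.injEq, hjs, and_false, false_or] at hi
        exact ⟨i, hi⟩
    · intro i j i' j' hb hi ho hj ho'
      rw [mem_erase] at hb
      have := h3 i j i' j' hb.2 hi (mem_insert_of_mem ho) hj (mem_insert_of_mem ho')
      rw [mem_insert] at this
      exact this.resolve_left hb.1
  · rintro ⟨h1, h2, h3⟩
    refine ⟨⟨?_, ?_, ?_⟩, h2 s hs⟩
    · intro x hx
      rw [mem_insert] at hx
      rcases hx with rfl | hx
      · exact hB
      · exact (mem_erase.1 (h1 hx)).2
    · intro j hj
      obtain ⟨i, hi⟩ := h2 j hj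
      exact ⟨i, mem_insert_of_mem hi⟩
    · intro i j i' j' hb hi ho hj ho'
      by_cases hij : (i, j) = (t, s)
      · simp [hij]
      simp only [mem_insert, Prod.mk.injEq] at ho ho' ⊢
      rcases ho with ⟨rfl, rfl⟩ | ho
      · exact absurd (hcol i hb) (by omega)
      · rcases ho' with ⟨rfl, rfl⟩ | ho'
        · exact absurd (hrow j hb) (by omega)
        · exact Or.inr (h3 i j i' j' (mem_erase.2 ⟨hij, hb⟩) hi ho hj ho')

theorem sum_insert_corner {F G : Finset (Finset (ℕ × ℕ))} {c : ℕ × ℕ}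
    (hG : ∀ O ∈ G, c ∉ O) (hF : ∀ O, c ∉ O → (insert c O ∈ F ↔ O ∈ G)) (hc : ∀ O ∈ F, c ∈ O) :
    ∑ O ∈ F, (X : ℕ[X]) ^ #O = X * ∑ O ∈ G, X ^ #O := by
  rw [mul_sum]
  symm
  refine sum_bij (fun O _ => insert c O) (fun O h => (hF O (hG O h)).2 h) ?_ ?_ ?_
  · intro O h O' h' he
    rw [← erase_insert (hG O h), he, erase_insert (hG O' h')]
  · intro O h
    refine ⟨O.erase c, ?_, insert_erase (hc O h)⟩
    rw [← hF _ (notMem_erase c O), insert_erase (hc O h)]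
    exact h
  · intro O h
    rw [card_insert_of_notMem (hG O h), pow_succ']

theorem fillingGF_corner {C : Finset ℕ} {B : Finset (ℕ × ℕ)} {t s : ℕ}
    (hc : IsCorner B t s) (hs : s ∈ C) :
    fillingGF C B = X * fillingGF C (B.erase (t, s)) +
      X * fillingGF (C.erase s) {x ∈ B | x.2 ≠ s} + fillingGF C {x ∈ B | x.1 ≠ t} := by
  classical
  have e0 : ∑ O ∈ fillings C B with (t, s) ∉ O, (X : ℕ[X]) ^ #O =
      fillingGF C {x ∈ B | x.1 ≠ t} := by
    refine sum_congr ?_ fun _ _ => rfl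
    ext O
    rw [mem_filter, mem_fillings, mem_fillings, isFilling_row_zero hc hs]
  have e1 : ∑ O ∈ (fillings C B).filter (fun O => (t, s) ∈ O) with ∃ i, i ≠ t ∧ (i, s) ∈ O,
      (X : ℕ[X]) ^ #O = X * fillingGF C (B.erase (t, s)) := by
    refine sum_insert_corner (c := (t, s)) ?_ ?_ ?_
    · intro O hO h
      exact notMem_erase _ _ ((mem_fillings.1 hO).1 h)
    · intro O hO
      rw [mem_fillings, ← isFilling_insert_erase hc hs hO, mem_filter, mem_filter, mem_fillings]
      refine ⟨fun h => ⟨h.1.1, ?_⟩, fun h => ⟨⟨h.1, mem_insert_self _ _⟩, ?_⟩⟩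
      · obtain ⟨i, hi, hm⟩ := h.2
        simp only [mem_insert, Prod.mk.injEq, hi, false_and, false_or] at hm
        exact ⟨i, hm⟩
      · obtain ⟨i, hi⟩ := h.2
        refine ⟨i, ?_, mem_insert_of_mem hi⟩
        rintro rfl
        exact hO hi
    · intro O hO
      rw [mem_filter, mem_filter] at hO
      exact hO.1.2
  have e2 : ∑ O ∈ (fillings C B).filter (fun O => (t, s) ∈ O) with ¬ ∃ i, i ≠ t ∧ (i, s) ∈ O,
      (X : ℕ[X]) ^ #O = X * fillingGF (C.erase s) {x ∈ B | x.2 ≠ s} := by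
    refine sum_insert_corner (c := (t, s)) ?_ ?_ ?_
    · intro O hO h
      simpa using (mem_filter.1 ((mem_fillings.1 hO).1 h)).2
    · intro O hO
      rw [mem_fillings, ← isFilling_insert_column hc hO, mem_filter, mem_filter, mem_fillings]
      refine ⟨fun h => ⟨h.1.1, ?_⟩, fun h => ⟨⟨h.1, mem_insert_self _ _⟩, ?_⟩⟩
      · rintro ⟨i, hi⟩
        refine h.2 ⟨i, ?_, mem_insert_of_mem hi⟩
        rintro rfl
        exact hO hi
      · rintro ⟨i, hi, hm⟩
        simp only [mem_insert, Prod.mk.injEq, hi, false_and, false_or] at hm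
        exact h.2 ⟨i, hm⟩
    · intro O hO
      rw [mem_filter, mem_filter] at hO
      exact hO.1.2
  rw [← e0, ← e1, ← e2, sum_filter_add_sum_filter_not, sum_filter_add_sum_filter_not]
  rfl

/-! ### Diagrams of labelled lattice paths and their corners -/

/-- The rows of the diagram below a lattice path with labelled steps; there is a row `0`. -/
def rows : List (Bool × ℕ) → Finset ℕ
  | [] => {0}
  | (true, t) :: l => insert t (rows l)
  | (false, _) :: l => rows l

/-- The columns of the diagram below a lattice path with labelled steps. -/
def cols : List (Bool × ℕ) → Finset ℕ
  | [] => ∅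
  | (true, _) :: l => cols l
  | (false, s) :: l => insert s (cols l)

/-- The boxes of the diagram below a lattice path with labelled steps. -/
def boxes : List (Bool × ℕ) → Finset (ℕ × ℕ)
  | [] => ∅
  | (true, _) :: l => boxes l
  | (false, s) :: l => boxes l ∪ rows l ×ˢ {s}

/-- The labels of the rows increase along the path, and so do the labels of the columns. -/
def WellLabelled : List (Bool × ℕ) → Prop
  | [] => True
  | (true, t) :: l => WellLabelled l ∧ ∀ i ∈ rows l, i < t
  | (false, s) :: l => WellLabelled l ∧ ∀ j ∈ cols l, j < s

theorem mem_boxes {l : List (Bool × ℕ)} {x : ℕ × ℕ} (h : x ∈ boxes l) :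
    x.1 ∈ rows l ∧ x.2 ∈ cols l := by
  induction l with
  | nil => simp [boxes] at h
  | cons a l ih =>
    obtain ⟨_ | _, r⟩ := a
    · simp only [boxes, mem_union, mem_product, mem_singleton] at h
      rcases h with h | h
      · exact ⟨(ih h).1, mem_insert_of_mem (ih h).2⟩
      · exact ⟨h.1, by simp [cols, h.2]⟩
    · exact ⟨mem_insert_of_mem (ih h).1, (ih h).2⟩

section Corner

variable {s t : ℕ} {u : List (Bool × ℕ)}

theorem rows_corner_swap (v : List (Bool × ℕ)) :
    rows (v ++ (true, t) :: (false, s) :: u) = rows (v ++ (false, s) :: (true, t) :: u) := by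
  induction v with
  | nil => rfl
  | cons a v ih => obtain ⟨_ | _, r⟩ := a <;> simp [rows, ih]

theorem cols_corner_swap (v : List (Bool × ℕ)) :
    cols (v ++ (true, t) :: (false, s) :: u) = cols (v ++ (false, s) :: (true, t) :: u) := by
  induction v with
  | nil => rfl
  | cons a v ih => obtain ⟨_ | _, r⟩ := a <;> simp [cols, ih]

theorem rows_delete_column (v : List (Bool × ℕ)) :
    rows (v ++ (true, t) :: u) = rows (v ++ (false, s) :: (true, t) :: u) := by
  induction v with
  | nil => rfl
  | cons a v ih => obtain ⟨_ | _, r⟩ := a <;> simp [rows, ih]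

theorem cols_delete_row (v : List (Bool × ℕ)) :
    cols (v ++ (false, s) :: u) = cols (v ++ (false, s) :: (true, t) :: u) := by
  induction v with
  | nil => rfl
  | cons a v ih => obtain ⟨_ | _, r⟩ := a <;> simp [cols, ih]

theorem row_mem_rows (v : List (Bool × ℕ)) : t ∈ rows (v ++ (false, s) :: (true, t) :: u) := by
  induction v with
  | nil => simp [rows]
  | cons a v ih => obtain ⟨_ | _, r⟩ := a <;> simp [rows, ih]

theorem column_mem_cols (v : List (Bool × ℕ)) :
    s ∈ cols (v ++ (false, s) :: (true, t) :: u) := by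
  induction v with
  | nil => simp [cols]
  | cons a v ih => obtain ⟨_ | _, r⟩ := a <;> simp [cols, ih]

theorem cols_delete_column (v : List (Bool × ℕ))
    (h : WellLabelled (v ++ (false, s) :: (true, t) :: u)) :
    cols (v ++ (true, t) :: u) = (cols (v ++ (false, s) :: (true, t) :: u)).erase s := by
  induction v with
  | nil =>
    have hs : s ∉ cols u := fun hs => lt_irrefl s (h.2 s hs)
    simp [cols, hs]
  | cons a v ih =>
    obtain ⟨_ | _, r⟩ := a
    · have hr : r ≠ s := (h.2 s (column_mem_cols v)).ne'
      simp only [List.cons_append, cols, ih h.1, erase_insert_of_ne hr]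
    · exact ih h.1

theorem rows_delete_row (v : List (Bool × ℕ))
    (h : WellLabelled (v ++ (false, s) :: (true, t) :: u)) :
    rows (v ++ (false, s) :: u) = (rows (v ++ (false, s) :: (true, t) :: u)).erase t := by
  induction v with
  | nil =>
    have ht : t ∉ rows u := fun ht => lt_irrefl t (h.1.2 t ht)
    simp [rows, ht]
  | cons a v ih =>
    obtain ⟨_ | _, r⟩ := a
    · exact ih h.1
    · have hr : r ≠ t := (h.2 t (row_mem_rows v)).ne'
      simp only [List.cons_append, rows, ih h.1, erase_insert_of_ne hr]

theorem wellLabelled_swap (v : List (Bool × ℕ))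
    (h : WellLabelled (v ++ (false, s) :: (true, t) :: u)) :
    WellLabelled (v ++ (true, t) :: (false, s) :: u) := by
  induction v with
  | nil => exact ⟨⟨h.1.1, h.2⟩, h.1.2⟩
  | cons a v ih =>
    obtain ⟨_ | _, r⟩ := a <;> simp only [List.cons_append, WellLabelled] at h ⊢
    · exact ⟨ih h.1, fun j hj => h.2 j (by rwa [cols_corner_swap] at hj)⟩
    · exact ⟨ih h.1, fun j hj => h.2 j (by rwa [rows_corner_swap] at hj)⟩

theorem wellLabelled_delete_column (v : List (Bool × ℕ))
    (h : WellLabelled (v ++ (false, s) :: (true, t) :: u)) :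
    WellLabelled (v ++ (true, t) :: u) := by
  induction v with
  | nil => exact h.1
  | cons a v ih =>
    obtain ⟨_ | _, r⟩ := a <;> simp only [List.cons_append, WellLabelled] at h ⊢
    · refine ⟨ih h.1, fun j hj => h.2 j ?_⟩
      rw [cols_delete_column v h.1] at hj
      exact mem_of_mem_erase hj
    · exact ⟨ih h.1, fun j hj => h.2 j (by rwa [← rows_delete_column])⟩

theorem wellLabelled_delete_row (v : List (Bool × ℕ))
    (h : WellLabelled (v ++ (false, s) :: (true, t) :: u)) :
    WellLabelled (v ++ (false, s) :: u) := by
  induction v with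
  | nil => exact ⟨h.1.1, h.2⟩
  | cons a v ih =>
    obtain ⟨_ | _, r⟩ := a <;> simp only [List.cons_append, WellLabelled] at h ⊢
    · exact ⟨ih h.1, fun j hj => h.2 j (by rwa [← cols_delete_row])⟩
    · refine ⟨ih h.1, fun j hj => h.2 j ?_⟩
      rw [rows_delete_row v h.1] at hj
      exact mem_of_mem_erase hj

/-- Row `t` is created just before column `s`: it is the lowest row met by that column, and it has
no earlier box. Later columns lie further left, and later rows do not meet column `s`. -/
theorem isCorner_boxes (v : List (Bool × ℕ))
    (h : WellLabelled (v ++ (false, s) :: (true, t) :: u)) :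
    IsCorner (boxes (v ++ (false, s) :: (true, t) :: u)) t s := by
  induction v with
  | nil =>
    have hs : s ∉ cols u := fun hs => lt_irrefl s (h.2 s hs)
    refine ⟨by simp [boxes, rows], fun i hi => ?_, fun j hj => ?_⟩
    · simp only [List.nil_append, boxes, rows, mem_union, mem_product, mem_insert,
        mem_singleton, and_true] at hi
      rcases hi with hi | hi | hi
      · exact absurd (mem_boxes hi).2 hs
      · exact hi.le
      · exact (h.1.2 i hi).le
    · simp only [List.nil_append, boxes, rows, mem_union, mem_product, mem_insert,
        mem_singleton, true_or, true_and] at hj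
      rcases hj with hj | hj
      · exact absurd (h.1.2 t (mem_boxes hj).1) (lt_irrefl t)
      · exact hj.ge
  | cons a v ih =>
    obtain ⟨_ | _, r⟩ := a
    · obtain ⟨h1, h2, h3⟩ := ih h.1
      have hr : s < r := h.2 s (column_mem_cols v)
      refine ⟨mem_union_left _ h1, fun i hi => ?_, fun j hj => ?_⟩
      · simp only [List.cons_append, boxes, mem_union, mem_product, mem_singleton, hr.ne,
          and_false, or_false] at hi
        exact h2 i hi
      · simp only [List.cons_append, boxes, mem_union, mem_product, mem_singleton] at hj
        rcases hj with hj | hj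
        · exact h3 j hj
        · rw [hj.2]
          exact hr.le
    · exact ih h.1

theorem boxes_corner_swap (v : List (Bool × ℕ))
    (h : WellLabelled (v ++ (false, s) :: (true, t) :: u)) :
    boxes (v ++ (true, t) :: (false, s) :: u) =
      (boxes (v ++ (false, s) :: (true, t) :: u)).erase (t, s) := by
  induction v with
  | nil =>
    have hs : s ∉ cols u := fun hs => lt_irrefl s (h.2 s hs)
    have ht : t ∉ rows u := fun ht => lt_irrefl t (h.1.2 t ht)
    ext ⟨i, j⟩
    simp only [List.nil_append, boxes, rows, mem_union, mem_product, mem_insert, mem_singleton,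
      mem_erase, ne_eq, Prod.mk.injEq]
    constructor
    · rintro (hb | hb)
      · exact ⟨fun e => hs (e.2 ▸ (mem_boxes hb).2), Or.inl hb⟩
      · exact ⟨fun e => ht (e.1 ▸ hb.1), Or.inr ⟨Or.inr hb.1, hb.2⟩⟩
    · tauto
  | cons a v ih =>
    obtain ⟨_ | _, r⟩ := a
    · have hr : s < r := h.2 s (column_mem_cols v)
      simp only [List.cons_append, boxes, ih h.1, rows_corner_swap]
      rw [erase_union_distrib]
      congr 1
      rw [erase_eq_of_notMem]
      simp [hr.ne']
    · exact ih h.1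

theorem boxes_delete_column (v : List (Bool × ℕ))
    (h : WellLabelled (v ++ (false, s) :: (true, t) :: u)) :
    boxes (v ++ (true, t) :: u) =
      {x ∈ boxes (v ++ (false, s) :: (true, t) :: u) | x.2 ≠ s} := by
  induction v with
  | nil =>
    have hs : s ∉ cols u := fun hs => lt_irrefl s (h.2 s hs)
    ext ⟨i, j⟩
    simp only [List.nil_append, boxes, rows, mem_union, mem_product, mem_insert, mem_singleton,
      mem_filter]
    constructor
    · exact fun hb => ⟨Or.inl hb, fun e => hs (e ▸ (mem_boxes hb).2)⟩
    · tauto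
  | cons a v ih =>
    obtain ⟨_ | _, r⟩ := a
    · have hr : s < r := h.2 s (column_mem_cols v)
      simp only [List.cons_append, boxes, ih h.1, ← rows_delete_column, filter_union]
      congr 1
      symm
      rw [filter_eq_self]
      rintro ⟨i, j⟩ hx
      simp only [mem_product, mem_singleton] at hx
      simpa [hx.2] using hr.ne'
    · exact ih h.1

theorem boxes_delete_row (v : List (Bool × ℕ))
    (h : WellLabelled (v ++ (false, s) :: (true, t) :: u)) :
    boxes (v ++ (false, s) :: u) =
      {x ∈ boxes (v ++ (false, s) :: (true, t) :: u) | x.1 ≠ t} := by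
  induction v with
  | nil =>
    have ht : t ∉ rows u := fun ht => lt_irrefl t (h.1.2 t ht)
    ext ⟨i, j⟩
    simp only [List.nil_append, boxes, rows, mem_union, mem_product, mem_insert, mem_singleton,
      mem_filter]
    constructor
    · rintro (hb | hb)
      · exact ⟨Or.inl hb, fun e => ht (e ▸ (mem_boxes hb).1)⟩
      · exact ⟨Or.inr ⟨Or.inr hb.1, hb.2⟩, fun e => ht (e ▸ hb.1)⟩
    · tauto
  | cons a v ih =>
    obtain ⟨_ | _, r⟩ := a
    · simp only [List.cons_append, boxes, ih h.1, rows_delete_row v h.1, filter_union]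
      congr 1
      ext ⟨i, j⟩
      simp only [mem_product, mem_erase, mem_singleton, mem_filter]
      tauto
    · exact ih h.1

theorem fillingGF_boxes_corner (v : List (Bool × ℕ))
    (h : WellLabelled (v ++ (false, s) :: (true, t) :: u)) :
    fillingGF (cols (v ++ (false, s) :: (true, t) :: u))
        (boxes (v ++ (false, s) :: (true, t) :: u)) =
      X * fillingGF (cols (v ++ (true, t) :: (false, s) :: u))
          (boxes (v ++ (true, t) :: (false, s) :: u)) +
        X * fillingGF (cols (v ++ (true, t) :: u)) (boxes (v ++ (true, t) :: u)) +
        fillingGF (cols (v ++ (false, s) :: u)) (boxes (v ++ (false, s) :: u)) := by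
  rw [fillingGF_corner (isCorner_boxes v h) (column_mem_cols v), boxes_corner_swap v h,
    boxes_delete_column v h, boxes_delete_row v h, cols_corner_swap, cols_delete_column v h,
    ← cols_delete_row]

end Corner

/-! ### Fillings of a diagram are counted by histories -/

/-- The number of pairs formed by a letter `true` and a letter `false` to its right. -/
def twos : List Bool → ℕ
  | [] => 0
  | true :: w => twos w + w.count false
  | false :: w => twos w

/-- The number of pairs formed by a letter `false` and a letter `true` to its right. -/
def inversions : List Bool → ℕ
  | [] => 0
  | true :: w => inversions w
  | false :: w => inversions w + w.count true

theorem inversions_append_swap (v u : List Bool) :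
    inversions (v ++ false :: true :: u) = inversions (v ++ true :: false :: u) + 1 := by
  induction v with
  | nil =>
    simp [inversions]
    omega
  | cons x v ih =>
    cases x
    · simp [inversions, ih]
      omega
    · simpa [inversions] using ih

theorem sorted_or_exists_corner (l : List (Bool × ℕ)) :
    (∃ b a, l.map Prod.fst = List.replicate b true ++ List.replicate a false) ∨
      ∃ v s t u, l = v ++ (false, s) :: (true, t) :: u := by
  induction l with
  | nil => exact Or.inl ⟨0, 0, rfl⟩
  | cons x l ih =>
    rcases ih with ⟨b, a, h⟩ | ⟨v, s, t, u, rfl⟩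
    · obtain ⟨_ | _, r⟩ := x
      · rcases b with _ | b
        · exact Or.inl ⟨0, a + 1, by simpa [List.replicate_succ] using h⟩
        · rcases l with _ | ⟨⟨y, t⟩, u⟩
          · simp at h
          · simp only [List.map_cons, List.replicate_succ, List.cons_append,
              List.cons.injEq] at h
            exact Or.inr ⟨[], r, t, u, by simp [h.1]⟩
      · exact Or.inl ⟨b + 1, a, by simp [h, List.replicate_succ]⟩
    · exact Or.inr ⟨x :: v, s, t, u, rfl⟩

theorem boxes_of_map_fst_eq_replicate {a : ℕ} {l : List (Bool × ℕ)}
    (h : l.map Prod.fst = List.replicate a false) : rows l = {0} ∧ boxes l = {0} ×ˢ cols l := by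
  induction l generalizing a with
  | nil => simp [rows, boxes, cols]
  | cons x l ih =>
    obtain ⟨y, r⟩ := x
    rcases a with _ | a
    · simp at h
    · simp only [List.map_cons, List.replicate_succ, List.cons.injEq] at h
      obtain ⟨rfl, h⟩ := h
      obtain ⟨h1, h2⟩ := ih h
      refine ⟨h1, ?_⟩
      rw [boxes, cols, h1, h2, insert_eq, union_comm, product_union]

theorem card_cols {l : List (Bool × ℕ)} (h : WellLabelled l) :
    #(cols l) = (l.map Prod.fst).count false := by
  induction l with
  | nil => rfl
  | cons x l ih =>
    obtain ⟨_ | _, r⟩ := x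
    · rw [cols, card_insert_of_notMem fun hr => lt_irrefl r (h.2 r hr), ih h.1]
      simp
    · rw [cols, ih h.1]
      simp

theorem fillingGF_single_row (C : Finset ℕ) : fillingGF C ({0} ×ˢ C) = X ^ #C := by
  have : fillings C ({0} ×ˢ C) = {{0} ×ˢ C} := by
    ext O
    rw [mem_fillings, mem_singleton]
    constructor
    · rintro ⟨h1, h2, -⟩
      refine h1.antisymm ?_
      rintro ⟨i, j⟩ hx
      obtain ⟨rfl, hj⟩ : i = 0 ∧ j ∈ C := by simpa [eq_comm, and_comm] using hx
      obtain ⟨i, hi⟩ := h2 j hj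
      obtain ⟨rfl, -⟩ : i = 0 ∧ j ∈ C := by simpa [eq_comm, and_comm] using h1 hi
      exact hi
    · rintro rfl
      exact ⟨subset_rfl, fun j hj => ⟨0, by simpa using hj⟩, fun i j i' j' h hi => by
        simp only [mem_product, mem_singleton] at h
        omega⟩
  rw [fillingGF, this, sum_singleton, card_product, card_singleton, one_mul]

/-- Here all columns are created before any new row, so the diagram is row 0 alone and must be
filled with `1`'s. -/
theorem fillingGF_sorted {b a : ℕ} {l : List (Bool × ℕ)} (hl : WellLabelled l)
    (h : l.map Prod.fst = List.replicate b true ++ List.replicate a false) :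
    fillingGF (cols l) (boxes l) = X ^ a := by
  induction b generalizing l with
  | zero =>
    have h' : l.map Prod.fst = List.replicate a false := by simpa using h
    rw [(boxes_of_map_fst_eq_replicate h').2, fillingGF_single_row, card_cols hl, h']
    simp
  | succ b ih =>
    rcases l with _ | ⟨⟨y, r⟩, l⟩
    · simp at h
    · simp only [List.map_cons, List.replicate_succ, List.cons_append, List.cons.injEq] at h
      obtain ⟨rfl, h⟩ := h
      change fillingGF (cols l) (boxes l) = _
      exact ih hl.1 h

/-- Both sides obey the corner recurrence and agree on words without a corner. Deleting a column
loses a factor `X` in `X ^ count false`; the `X` in front of that term of the filling recurrence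
restores it. -/
theorem fillingGF_boxes (l : List (Bool × ℕ)) (hl : WellLabelled l) :
    fillingGF (cols l) (boxes l) =
      X ^ (l.map Prod.fst).count false * wordGF (l.map Prod.fst) := by
  rcases sorted_or_exists_corner l with ⟨b, a, h⟩ | ⟨v, s, t, u, rfl⟩
  · rw [fillingGF_sorted hl h, h, wordGF_sorted]
    simp [List.count_replicate]
  · rw [fillingGF_boxes_corner v hl, fillingGF_boxes _ (wellLabelled_swap v hl),
      fillingGF_boxes _ (wellLabelled_delete_column v hl),
      fillingGF_boxes _ (wellLabelled_delete_row v hl)]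
    simp only [List.map_append, List.map_cons, wordGF_append_swap, List.count_append,
      List.count_cons_self, List.count_cons_of_ne (show true ≠ false by decide)]
    ring
-- Removing the corner box keeps the length and removes one inversion; deleting a row or a column
-- shortens the path.
termination_by (l.length, inversions (l.map Prod.fst))
decreasing_by
  all_goals subst_vars
  · rw [Prod.lex_def]
    right
    simp [inversions_append_swap]
  · rw [Prod.lex_def]
    left
    simp
  · rw [Prod.lex_def]
    left
    simp

/-! ### The Laguerre history of a permutation -/

/-- The letter before `y` in `σ 0, σ 1, …`, or `0` if `y` is the first letter. -/
def prev (σ : Equiv.Perm ℕ) (y : ℕ) : ℕ := if σ.symm y = 0 then 0 else σ (σ.symm y - 1)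

/-- `y` is a descent bottom. -/
def isBot (σ : Equiv.Perm ℕ) (y : ℕ) : Bool := decide (y < prev σ y)

/-- `v` is a descent top. -/
def isTop (σ : Equiv.Perm ℕ) (v : ℕ) : Bool := decide (∃ y ∈ range v, prev σ y = v)

/-- The number of descents to the right of `v` that straddle `v`. -/
def rightStraddles (σ : Equiv.Perm ℕ) (v : ℕ) : ℕ :=
  #{y ∈ range v | v < prev σ y ∧ σ.symm v < σ.symm y}

/-- The number of descents with bottom below `s` and top at least `s`. -/
def height (σ : Equiv.Perm ℕ) (s : ℕ) : ℕ := #{y ∈ range s | s ≤ prev σ y}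

/-- The letters `v = s - 1, …, 1, 0`, marked `true` if they are descent bottoms. -/
def word (σ : Equiv.Perm ℕ) : ℕ → List Bool
  | 0 => []
  | s + 1 => isBot σ s :: word σ s

/-- The Laguerre history of `σ` up to the letter `s - 1`. -/
def code (σ : Equiv.Perm ℕ) : ℕ → List (Bool × ℕ)
  | 0 => []
  | s + 1 => (isTop σ s, rightStraddles σ s) :: code σ s

/-- The default value 0 of `prev` never makes the first letter a descent bottom, and positivity of
`prev` guarantees a genuine predecessor. -/
theorem symm_prev {σ : Equiv.Perm ℕ} {y : ℕ} (h : 0 < prev σ y) :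
    σ.symm y = σ.symm (prev σ y) + 1 := by
  unfold prev at h ⊢
  split_ifs at h ⊢ with h0
  · omega
  · rw [Equiv.symm_apply_apply]
    omega

theorem prev_apply_succ (σ : Equiv.Perm ℕ) (q : ℕ) : prev σ (σ (q + 1)) = σ q := by
  simp [prev]

theorem symm_of_prev_eq {σ : Equiv.Perm ℕ} {y v : ℕ} (hy : y < v) (h : prev σ y = v) :
    σ.symm y = σ.symm v + 1 := by
  rw [symm_prev (by omega), h]

theorem card_prev_eq (σ : Equiv.Perm ℕ) (v : ℕ) :
    #{y ∈ range v | prev σ y = v} = (isTop σ v).toNat := by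
  by_cases h : ∃ y ∈ range v, prev σ y = v
  · have h1 : isTop σ v = true := by simpa [isTop] using h
    rw [h1, Bool.toNat_true, card_eq_one]
    obtain ⟨y, hy, hyv⟩ := h
    refine ⟨y, ?_⟩
    ext z
    simp only [mem_filter, mem_singleton]
    constructor
    · rintro ⟨hz, hzv⟩
      apply σ.symm.injective
      rw [symm_of_prev_eq (mem_range.1 hz) hzv, symm_of_prev_eq (mem_range.1 hy) hyv]
    · rintro rfl
      exact ⟨hy, hyv⟩
  · have h1 : isTop σ v = false := by simpa [isTop] using h
    rw [h1, Bool.toNat_false, card_eq_zero, filter_eq_empty_iff]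
    exact fun y hy hyv => h ⟨y, hy, hyv⟩

/-- Call `y < v` with `v ≤ prev σ y` a block start at level `v`: it begins a maximal run of letters
below `v`. The block starts to the right of `v` are the straddling descents, plus the one directly
after `v` if `v` is a descent top. -/
theorem card_straddles_add (σ : Equiv.Perm ℕ) (v : ℕ) :
    #{y ∈ range v | v ≤ prev σ y ∧ σ.symm v < σ.symm y} =
      rightStraddles σ v + (isTop σ v).toNat := by
  rw [← card_prev_eq, rightStraddles, ← card_union_of_disjoint]
  · congr 1
    ext y
    simp only [mem_union, mem_filter]
    constructor
    · rintro ⟨hy, h1, h2⟩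
      rcases h1.lt_or_eq with h | h
      · exact Or.inl ⟨hy, h, h2⟩
      · exact Or.inr ⟨hy, h.symm⟩
    · rintro (⟨hy, h1, h2⟩ | ⟨hy, h1⟩)
      · exact ⟨hy, h1.le, h2⟩
      · exact ⟨hy, h1.ge, by rw [symm_of_prev_eq (mem_range.1 hy) h1]; omega⟩
  · rw [disjoint_filter]
    rintro y - h1 h2
    exact h1.1.ne' h2

theorem rightStraddles_add_le (σ : Equiv.Perm ℕ) (v : ℕ) :
    rightStraddles σ v + (isTop σ v).toNat ≤ height σ v := by
  rw [← card_straddles_add]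
  exact card_le_card (monotone_filter_right _ fun y _ h => h.1)

/-- Passing from level `v` to `v + 1` gains the descent with bottom `v` and loses the descent with
top `v`. -/
theorem height_succ (σ : Equiv.Perm ℕ) (v : ℕ) :
    height σ (v + 1) + (isTop σ v).toNat = height σ v + (isBot σ v).toNat := by
  have e1 : height σ (v + 1) = #{y ∈ range v | v < prev σ y} + (isBot σ v).toNat := by
    simp only [height, range_add_one, filter_insert, Nat.add_one_le_iff]
    by_cases h : v < prev σ v
    · rw [if_pos h, card_insert_of_notMem (by simp)]
      simp [isBot, h]
    · rw [if_neg h]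
      simp [isBot, h]
  have e2 : height σ v = #{y ∈ range v | v < prev σ y} + (isTop σ v).toNat := by
    rw [← card_prev_eq, height, ← card_union_of_disjoint]
    · congr 1
      ext y
      simp only [mem_union, mem_filter, le_iff_lt_or_eq, eq_comm (a := v)]
      tauto
    · rw [disjoint_filter]
      rintro y - h1 h2
      exact h1.ne' h2
  omega

theorem code_mem_histories (σ : Equiv.Perm ℕ) (s : ℕ) :
    code σ s ∈ histories (word σ s) (height σ s) := by
  induction s with
  | zero => simp [code, word, height, histories]
  | succ s ih =>
    have h1 := rightStraddles_add_le σ s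
    have h2 := height_succ σ s
    rw [code, word]
    cases hb : isBot σ s <;> cases ht : isTop σ s <;>
      simp only [hb, ht, Bool.toNat_true, Bool.toNat_false] at h1 h2 <;>
      simp only [histories, mem_union, mem_extend, true_and, reduceCtorEq, false_and, or_false,
        false_or]
    · exact ⟨by omega, by rwa [show height σ (s + 1) = height σ s by omega]⟩
    · exact ⟨by omega, by rwa [show height σ (s + 1) + 1 = height σ s by omega]⟩
    · exact ⟨by omega, by rwa [show height σ (s + 1) - 1 = height σ s by omega]⟩
    · exact ⟨by omega, by rwa [show height σ (s + 1) = height σ s by omega]⟩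

/-- Walk left from position `q` until the run of letters below `v` begins; this happens before `v`
itself is reached. -/
theorem exists_block_start {σ : Equiv.Perm ℕ} {v : ℕ} (q : ℕ) (h1 : σ.symm v < q)
    (h2 : σ q < v) : ∃ y < v, v ≤ prev σ y ∧ σ.symm v < σ.symm y ∧ σ.symm y ≤ q := by
  induction q with
  | zero => omega
  | succ q ih =>
    by_cases h : σ q < v
    · have hq : σ.symm v ≠ q := by
        rintro rfl
        simp at h
      obtain ⟨y, hy, h3, h4, h5⟩ := ih (by omega) h
      exact ⟨y, hy, h3, h4, by omega⟩
    · refine ⟨σ (q + 1), h2, ?_, ?_, ?_⟩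
      · rw [prev_apply_succ]
        omega
      · simpa using h1
      · simp

/-- This locates `v` among the smaller letters using only their order, the block starts and the code
at `v`: if `v` is to the left of `x`, some block start lies right of `v` but not right of `x`, so
the two counts differ strictly. -/
theorem symm_lt_iff_card_lt {σ : Equiv.Perm ℕ} {v x : ℕ} (hx : x < v) :
    σ.symm v < σ.symm x ↔ #{y ∈ range v | v ≤ prev σ y ∧ σ.symm x < σ.symm y} <
      rightStraddles σ v + (isTop σ v).toNat := by
  rw [← card_straddles_add]
  constructor
  · intro h
    obtain ⟨y, hy, h1, h2, h3⟩ := exists_block_start (σ.symm x) h (by simpa using hx)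
    refine card_lt_card (ssubset_iff_of_subset ?_ |>.2 ⟨y, ?_, ?_⟩)
    · exact monotone_filter_right _ fun z _ hz => ⟨hz.1, h.trans hz.2⟩
    · exact mem_filter.2 ⟨mem_range.2 hy, h1, h2⟩
    · exact fun hm => absurd (mem_filter.1 hm).2.2 (by omega)
  · intro h
    by_contra hn
    refine absurd h (not_lt.2 (card_le_card ?_))
    exact monotone_filter_right _ fun z _ hz => ⟨hz.1, (not_lt.1 hn).trans_lt hz.2⟩

/-- The bottom below a descent top `v` is the first block start to the right of `v`; this tells
which block start is lost at the next level. -/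
theorem prev_eq_iff {σ : Equiv.Perm ℕ} {x v : ℕ} (hx : x < v) :
    prev σ x = v ↔ isTop σ v = true ∧ σ.symm v < σ.symm x ∧ v ≤ prev σ x ∧
      ∀ y < v, v ≤ prev σ y → σ.symm v < σ.symm y → ¬ σ.symm y < σ.symm x := by
  constructor
  · intro h
    have := symm_of_prev_eq hx h
    refine ⟨?_, by omega, h.ge, fun y _ _ _ => by omega⟩
    simp only [isTop, decide_eq_true_eq]
    exact ⟨x, mem_range.2 hx, h⟩
  · rintro ⟨h1, h2, -, h3⟩
    simp only [isTop, decide_eq_true_eq, mem_range] at h1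
    obtain ⟨y, hy, h⟩ := h1
    have h4 := symm_of_prev_eq hy h
    have h5 := h3 y hy h.ge (by omega)
    have h6 : x = y := σ.symm.injective (by omega)
    rw [h6, h]

/-- The induction must carry two data: the relative order of the letters below `s` and the set of
block starts at level `s`. Together with the code they determine the same data at level `s + 1`. -/
theorem symm_lt_symm_iff_of_code_eq {σ τ : Equiv.Perm ℕ} {n : ℕ}
    (hb : ∀ v < n, isBot σ v = isBot τ v) (ht : ∀ v < n, isTop σ v = isTop τ v)
    (hr : ∀ v < n, rightStraddles σ v = rightStraddles τ v) (s : ℕ) (hs : s ≤ n) :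
    (∀ x < s, ∀ y < s, σ.symm x < σ.symm y ↔ τ.symm x < τ.symm y) ∧
      ∀ x < s, s ≤ prev σ x ↔ s ≤ prev τ x := by
  induction s with
  | zero => simp
  | succ s ih =>
    obtain ⟨h1, h2⟩ := ih (by omega)
    have hss : s < n := hs
    have key : ∀ x < s, σ.symm s < σ.symm x ↔ τ.symm s < τ.symm x := by
      intro x hx
      rw [symm_lt_iff_card_lt hx, symm_lt_iff_card_lt hx, hr s hss, ht s hss]
      have : {y ∈ range s | s ≤ prev σ y ∧ σ.symm x < σ.symm y} =
          {y ∈ range s | s ≤ prev τ y ∧ τ.symm x < τ.symm y} := by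
        refine filter_congr fun y hy => ?_
        rw [mem_range] at hy
        rw [h1 x hx y hy, h2 y hy]
      rw [this]
    have key' : ∀ x < s, σ.symm x < σ.symm s ↔ τ.symm x < τ.symm s := by
      intro x hx
      have n1 : σ.symm x ≠ σ.symm s := fun h => hx.ne (σ.symm.injective h)
      have n2 : τ.symm x ≠ τ.symm s := fun h => hx.ne (τ.symm.injective h)
      have := key x hx
      omega
    constructor
    · intro x hx y hy
      rcases Nat.lt_succ_iff_lt_or_eq.1 hx with hx | rfl
      · rcases Nat.lt_succ_iff_lt_or_eq.1 hy with hy | rfl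
        · exact h1 x hx y hy
        · exact key' x hx
      · rcases Nat.lt_succ_iff_lt_or_eq.1 hy with hy | rfl
        · exact key y hy
        · simp
    · intro x hx
      rcases Nat.lt_succ_iff_lt_or_eq.1 hx with hx | rfl
      · have e : prev σ x = s ↔ prev τ x = s := by
          rw [prev_eq_iff hx, prev_eq_iff hx, ht s hss, key x hx, h2 x hx]
          refine and_congr_right fun _ => and_congr_right fun _ => and_congr_right fun _ => ?_
          refine forall_congr' fun y => forall_congr' fun hy => ?_
          rw [h2 y hy, key y hy, h1 y hy x hx]
        have := h2 x hx
        omega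
      · simpa [isBot, Nat.succ_le_iff] using hb x hss

/-! ### Bijectivity of the encoding -/

theorem apply_lt_iff {σ : Equiv.Perm ℕ} {n : ℕ} (h : ∀ x, n ≤ x → σ x = x) (x : ℕ) :
    σ x < n ↔ x < n := by
  by_cases hx : x < n
  · refine iff_of_true ?_ hx
    by_contra hn
    have := σ.injective (h (σ x) (not_lt.1 hn))
    omega
  · rw [h x (not_lt.1 hx)]

theorem symm_lt_iff {σ : Equiv.Perm ℕ} {n : ℕ} (h : ∀ x, n ≤ x → σ x = x) (x : ℕ) :
    σ.symm x < n ↔ x < n := by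
  rw [← apply_lt_iff h (σ.symm x), Equiv.apply_symm_apply]

/-- This recovers absolute positions from the relative order of the letters. -/
theorem card_symm_lt {σ : Equiv.Perm ℕ} {n : ℕ} (h : ∀ x, n ≤ x → σ x = x) {x : ℕ}
    (hx : x < n) : #{y ∈ range n | σ.symm y < σ.symm x} = σ.symm x := by
  have : ({y ∈ range n | σ.symm y < σ.symm x}).image σ.symm = range (σ.symm x) := by
    ext q
    simp only [mem_image, mem_filter, mem_range]
    constructor
    · rintro ⟨y, ⟨-, hy⟩, rfl⟩
      exact hy
    · intro hq
      refine ⟨σ q, ⟨?_, by simpa using hq⟩, by simp⟩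
      rw [apply_lt_iff h]
      exact hq.trans ((symm_lt_iff h x).2 hx)
  rw [← card_image_of_injective _ σ.symm.injective, this, card_range]

theorem isBot_eq_of_word_eq {σ τ : Equiv.Perm ℕ} {n : ℕ} (h : word σ n = word τ n) :
    ∀ v < n, isBot σ v = isBot τ v := by
  induction n with
  | zero => simp
  | succ n ih =>
    simp only [word, List.cons.injEq] at h
    intro v hv
    rcases Nat.lt_succ_iff_lt_or_eq.1 hv with hv | rfl
    · exact ih h.2 v hv
    · exact h.1

theorem step_eq_of_code_eq {σ τ : Equiv.Perm ℕ} {n : ℕ} (h : code σ n = code τ n) :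
    ∀ v < n, isTop σ v = isTop τ v ∧ rightStraddles σ v = rightStraddles τ v := by
  induction n with
  | zero => simp
  | succ n ih =>
    simp only [code, List.cons.injEq, Prod.mk.injEq] at h
    intro v hv
    rcases Nat.lt_succ_iff_lt_or_eq.1 hv with hv | rfl
    · exact ih h.2 v hv
    · exact h.1

theorem eq_of_code_eq {σ τ : Equiv.Perm ℕ} {n : ℕ} (hσ : ∀ x, n ≤ x → σ x = x)
    (hτ : ∀ x, n ≤ x → τ x = x) (hw : word σ n = word τ n) (hc : code σ n = code τ n) :
    σ = τ := by
  have h := (symm_lt_symm_iff_of_code_eq (isBot_eq_of_word_eq hw)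
    (fun v hv => (step_eq_of_code_eq hc v hv).1) (fun v hv => (step_eq_of_code_eq hc v hv).2)
    n le_rfl).1
  suffices hs : σ.symm = τ.symm by rw [← σ.symm_symm, hs, τ.symm_symm]
  ext x
  by_cases hx : x < n
  · rw [← card_symm_lt hσ hx, ← card_symm_lt hτ hx]
    congr 1
    exact filter_congr fun y hy => h y (mem_range.1 hy) x hx
  · rw [(Equiv.symm_apply_eq σ).2 (hσ x (not_lt.1 hx)).symm,
      (Equiv.symm_apply_eq τ).2 (hτ x (not_lt.1 hx)).symm]

theorem prev_lt {σ : Equiv.Perm ℕ} {n : ℕ} (h : ∀ x, n ≤ x → σ x = x) {y : ℕ} (hy : y < n) :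
    prev σ y < n := by
  unfold prev
  split_ifs
  · omega
  · rw [apply_lt_iff h]
    have := (symm_lt_iff h y).2 hy
    omega

theorem height_eq_zero {σ : Equiv.Perm ℕ} {n : ℕ} (h : ∀ x, n ≤ x → σ x = x) :
    height σ n = 0 := by
  rw [height, card_eq_zero, filter_eq_empty_iff]
  intro y hy
  exact not_le.2 (prev_lt h (mem_range.1 hy))

theorem length_word (σ : Equiv.Perm ℕ) (s : ℕ) : (word σ s).length = s := by
  induction s with
  | zero => rfl
  | succ s ih => rw [word, List.length_cons, ih]

/-- The extension of a permutation of `Fin n` to the natural numbers by the identity. -/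
def extendPerm {n : ℕ} (π : Equiv.Perm (Fin n)) : Equiv.Perm ℕ :=
  π.extendDomain Fin.equivSubtype

theorem extendPerm_apply {n : ℕ} (π : Equiv.Perm (Fin n)) (i : Fin n) :
    extendPerm π i = π i :=
  Equiv.Perm.extendDomain_apply_image π Fin.equivSubtype i

theorem extendPerm_symm_apply {n : ℕ} (π : Equiv.Perm (Fin n)) (i : Fin n) :
    (extendPerm π).symm i = π.symm i := by
  rw [Equiv.symm_apply_eq, extendPerm_apply, Equiv.apply_symm_apply]

theorem extendPerm_of_le {n : ℕ} (π : Equiv.Perm (Fin n)) (x : ℕ) (hx : n ≤ x) :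
    extendPerm π x = x :=
  Equiv.Perm.extendDomain_apply_not_subtype π Fin.equivSubtype (not_lt.2 hx)

theorem extendPerm_injective (n : ℕ) : Function.Injective (extendPerm (n := n)) :=
  Equiv.Perm.extendDomainHom_injective Fin.equivSubtype

theorem eq_of_word_eq_of_code_eq {n : ℕ} {π ρ : Equiv.Perm (Fin n)}
    (hw : word (extendPerm π) n = word (extendPerm ρ) n)
    (hc : code (extendPerm π) n = code (extendPerm ρ) n) : π = ρ :=
  extendPerm_injective n
    (eq_of_code_eq (extendPerm_of_le π) (extendPerm_of_le ρ) hw hc)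

theorem code_extendPerm_mem {n : ℕ} (π : Equiv.Perm (Fin n)) :
    code (extendPerm π) n ∈ histories (word (extendPerm π) n) 0 := by
  have := code_mem_histories (extendPerm π) n
  rwa [height_eq_zero (extendPerm_of_le π)] at this

theorem exists_perm_of_mem_histories {n : ℕ} {w : List Bool} (hw : w.length = n)
    {l : List (Bool × ℕ)} (hl : l ∈ histories w 0) :
    ∃ π : Equiv.Perm (Fin n), word (extendPerm π) n = w ∧ code (extendPerm π) n = l := by
  let f : Equiv.Perm (Fin n) → Σ _ : List Bool, List (Bool × ℕ) :=
    fun π => ⟨word (extendPerm π) n, code (extendPerm π) n⟩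
  have hf : Function.Injective f := by
    intro π ρ h
    simp only [f, Sigma.mk.injEq, heq_eq_eq] at h
    exact eq_of_word_eq_of_code_eq h.1 h.2
  -- Surjectivity comes from counting: both sides have `n!` elements and `f` is injective.
  have hS : univ.image f = (words n).sigma fun w => histories w 0 := by
    refine eq_of_subset_of_card_le ?_ ?_
    · intro x hx
      obtain ⟨π, -, rfl⟩ := mem_image.1 hx
      exact mem_sigma.2 ⟨mem_words.2 (length_word _ _), code_extendPerm_mem π⟩
    · rw [card_image_of_injective _ hf, card_univ, Fintype.card_perm, Fintype.card_fin,
        card_sigma, sum_card_histories, Nat.choose_zero_right, mul_one]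
  have hm : (⟨w, l⟩ : Σ _ : List Bool, List (Bool × ℕ)) ∈ univ.image f := by
    rw [hS]
    exact mem_sigma.2 ⟨mem_words.2 hw, hl⟩
  obtain ⟨π, -, h⟩ := mem_image.1 hm
  simp only [f, Sigma.mk.injEq, heq_eq_eq] at h
  exact ⟨π, h⟩

theorem sum_perm_word_eq {n : ℕ} {w : List Bool} (hw : w.length = n) :
    ∑ π : Equiv.Perm (Fin n) with word (extendPerm π) n = w,
      (X : ℕ[X]) ^ weight (code (extendPerm π) n) = histGF w 0 := by
  rw [histGF]
  refine sum_bij (fun π _ => code (extendPerm π) n) ?_ ?_ ?_ (fun _ _ => rfl)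
  · intro π hπ
    obtain rfl := (mem_filter.1 hπ).2
    exact code_extendPerm_mem π
  · intro π hπ ρ hρ h
    exact eq_of_word_eq_of_code_eq ((mem_filter.1 hπ).2.trans (mem_filter.1 hρ).2.symm) h
  · intro l hl
    obtain ⟨π, h1, h2⟩ := exists_perm_of_mem_histories hw hl
    exact ⟨π, mem_filter.2 ⟨mem_univ _, h1⟩, h2⟩

/-! ### Pattern counts in terms of letters -/

theorem prev_extendPerm {n : ℕ} (π : Equiv.Perm (Fin n)) {i j : Fin n} (h : (j : ℕ) = i + 1) :
    prev (extendPerm π) (π j) = π i := by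
  rw [prev, extendPerm_symm_apply, Equiv.symm_apply_apply, if_neg (by omega), h,
    Nat.add_sub_cancel, extendPerm_apply]

theorem symm_extendPerm {n : ℕ} (π : Equiv.Perm (Fin n)) (i : Fin n) :
    (extendPerm π).symm (π i) = i := by
  rw [extendPerm_symm_apply, Equiv.symm_apply_apply]

theorem exists_pred_of_lt_prev {n : ℕ} (π : Equiv.Perm (Fin n)) {y : ℕ} (hy : y < n)
    (h : y < prev (extendPerm π) y) :
    ∃ i j : Fin n, (j : ℕ) = i + 1 ∧ (π j : ℕ) = y ∧ (π i : ℕ) = prev (extendPerm π) y := by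
  have h1 := symm_prev (σ := extendPerm π) (y := y) (by omega)
  have h2 := extendPerm_symm_apply π ⟨y, hy⟩
  have hlt : prev (extendPerm π) y < n := prev_lt (extendPerm_of_le π) hy
  have h3 := extendPerm_symm_apply π ⟨_, hlt⟩
  refine ⟨π.symm ⟨_, hlt⟩, π.symm ⟨y, hy⟩, ?_, by simp, by simp⟩
  rw [← h2, ← h3]
  exact h1

theorem isOccurrence_left_iff {n : ℕ} {p : Fin 3 → ℕ} {π : Equiv.Perm (Fin n)}
    {f : Fin 3 → Fin n} : IsOccurrence p {1} π f ↔
      f 0 < f 1 ∧ (f 2 : ℕ) = f 1 + 1 ∧ ∀ x y, π (f x) < π (f y) ↔ p x < p y := by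
  constructor
  · rintro ⟨h1, h2, h3⟩
    exact ⟨h1 (by decide), h3 1 2 rfl rfl, h2⟩
  · rintro ⟨h1, h2, h3⟩
    refine ⟨?_, h3, ?_⟩
    · rw [Fin.strictMono_iff_lt_succ]
      intro i
      fin_cases i
      · exact h1
      · change f 1 < f 2
        omega
    · rintro x y hx hy
      have hx' : x = 1 := Fin.ext hx
      subst hx'
      have hy' : y = 2 := Fin.ext hy
      subst hy'
      exact h2

theorem isOccurrence_right_iff {n : ℕ} {p : Fin 3 → ℕ} {π : Equiv.Perm (Fin n)}
    {f : Fin 3 → Fin n} : IsOccurrence p {0} π f ↔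
      (f 1 : ℕ) = f 0 + 1 ∧ f 1 < f 2 ∧ ∀ x y, π (f x) < π (f y) ↔ p x < p y := by
  constructor
  · rintro ⟨h1, h2, h3⟩
    exact ⟨h3 0 1 rfl rfl, h1 (by decide), h2⟩
  · rintro ⟨h1, h2, h3⟩
    refine ⟨?_, h3, ?_⟩
    · rw [Fin.strictMono_iff_lt_succ]
      intro i
      fin_cases i
      · change f 0 < f 1
        omega
      · exact h2
    · rintro x y hx hy
      have hx' : x = 0 := Fin.ext hx
      subst hx'
      have hy' : y = 1 := Fin.ext hy
      subst hy'
      exact h1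

/-- An occurrence is determined by its isolated letter `x.1` and its descent bottom `x.2`, the
descent top being `prev`. The pattern only prescribes how `x.1` compares with the bottom and the
top. -/
theorem patternCount_left {n : ℕ} (p : Fin 3 → ℕ) (h21 : p 2 < p 1) (h01 : p 0 ≠ p 1)
    (h02 : p 0 ≠ p 2) (π : Equiv.Perm (Fin n)) :
    patternCount p {1} π = #{x ∈ range n ×ˢ range n | x.2 < prev (extendPerm π) x.2 ∧
      (extendPerm π).symm x.1 < (extendPerm π).symm x.2 ∧ (x.1 < x.2 ↔ p 0 < p 2) ∧
      (x.1 < prev (extendPerm π) x.2 ↔ p 0 < p 1) ∧ x.1 ≠ prev (extendPerm π) x.2} := by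
  rw [patternCount, ← Set.ncard_coe_finset]
  refine Set.ncard_congr (fun f _ => ((π (f 0) : ℕ), (π (f 2) : ℕ))) ?_ ?_ ?_
  · intro f hf
    obtain ⟨h1, h2, h3⟩ := isOccurrence_left_iff.1 hf
    have a1 := h3 2 1
    have a2 := h3 0 2
    have a3 := h3 0 1
    have a4 := h3 1 0
    simp only [coe_filter, mem_product, mem_range, Set.mem_ofPred_eq, Fin.is_lt, true_and,
      prev_extendPerm π h2, symm_extendPerm]
    omega
  · intro f g hf hg h
    obtain ⟨h1, h2, -⟩ := isOccurrence_left_iff.1 hf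
    obtain ⟨h3, h4, -⟩ := isOccurrence_left_iff.1 hg
    simp only [Prod.mk.injEq] at h
    have e0 : f 0 = g 0 := π.injective (Fin.ext h.1)
    have e2 : f 2 = g 2 := π.injective (Fin.ext h.2)
    ext i
    fin_cases i
    · simp [e0]
    · rw [e2] at h2
      change (f 1 : ℕ) = g 1
      omega
    · simp [e2]
  · rintro ⟨z, y⟩ h
    simp only [coe_filter, mem_product, mem_range, Set.mem_ofPred_eq] at h
    obtain ⟨⟨hz, hy⟩, h1, h2, h3, h4, h5⟩ := h
    obtain ⟨i, j, hij, rfl, hi⟩ := exists_pred_of_lt_prev π hy h1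
    obtain ⟨k, hk⟩ := π.surjective ⟨z, hz⟩
    obtain rfl : (π k : ℕ) = z := by rw [hk]
    rw [symm_extendPerm, symm_extendPerm] at h2
    rw [← hi] at h1 h4 h5
    refine ⟨![k, i, j], isOccurrence_left_iff.2 ⟨?_, hij, ?_⟩, rfl⟩
    -- Position `k` precedes `j = i + 1`, so excluding `k = i` puts it before `i`.
    · have : k ≠ i := by
        rintro rfl
        exact h5 rfl
      change k < i
      omega
    · have : k ≠ j := by
        rintro rfl
        exact lt_irrefl _ h2
      have : (π k : ℕ) ≠ π j := fun e => this (π.injective (Fin.ext e))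
      simp only [Fin.forall_fin_succ, Fin.lt_def, Matrix.cons_val_zero, Matrix.cons_val_succ,
        Fin.succ_zero_eq_one, Fin.succ_one_eq_two, IsEmpty.forall_iff, and_true]
      omega

theorem patternCount_right {n : ℕ} (p : Fin 3 → ℕ) (h10 : p 1 < p 0) (h20 : p 2 ≠ p 0)
    (h21 : p 2 ≠ p 1) (π : Equiv.Perm (Fin n)) :
    patternCount p {0} π = #{x ∈ range n ×ˢ range n | x.2 < prev (extendPerm π) x.2 ∧
      (extendPerm π).symm x.2 < (extendPerm π).symm x.1 ∧ (x.1 < x.2 ↔ p 2 < p 1) ∧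
      (x.1 < prev (extendPerm π) x.2 ↔ p 2 < p 0) ∧ x.1 ≠ prev (extendPerm π) x.2} := by
  rw [patternCount, ← Set.ncard_coe_finset]
  refine Set.ncard_congr (fun f _ => ((π (f 2) : ℕ), (π (f 1) : ℕ))) ?_ ?_ ?_
  · intro f hf
    obtain ⟨h1, h2, h3⟩ := isOccurrence_right_iff.1 hf
    have a1 := h3 1 0
    have a2 := h3 2 1
    have a3 := h3 2 0
    have a4 := h3 0 2
    simp only [coe_filter, mem_product, mem_range, Set.mem_ofPred_eq, Fin.is_lt, true_and,
      prev_extendPerm π h1, symm_extendPerm]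
    omega
  · intro f g hf hg h
    obtain ⟨h1, h2, -⟩ := isOccurrence_right_iff.1 hf
    obtain ⟨h3, h4, -⟩ := isOccurrence_right_iff.1 hg
    simp only [Prod.mk.injEq] at h
    have e0 : f 2 = g 2 := π.injective (Fin.ext h.1)
    have e2 : f 1 = g 1 := π.injective (Fin.ext h.2)
    ext i
    fin_cases i
    · rw [e2] at h1
      change (f 0 : ℕ) = g 0
      omega
    · simp [e2]
    · simp [e0]
  · rintro ⟨z, y⟩ h
    simp only [coe_filter, mem_product, mem_range, Set.mem_ofPred_eq] at h
    obtain ⟨⟨hz, hy⟩, h1, h2, h3, h4, h5⟩ := h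
    obtain ⟨i, j, hij, rfl, hi⟩ := exists_pred_of_lt_prev π hy h1
    obtain ⟨k, hk⟩ := π.surjective ⟨z, hz⟩
    obtain rfl : (π k : ℕ) = z := by rw [hk]
    rw [symm_extendPerm, symm_extendPerm] at h2
    rw [← hi] at h1 h4 h5
    refine ⟨![i, j, k], isOccurrence_right_iff.2 ⟨hij, h2, ?_⟩, rfl⟩
    have : k ≠ j := by
      rintro rfl
      exact lt_irrefl _ h2
    have : (π k : ℕ) ≠ π j := fun e => this (π.injective (Fin.ext e))
    simp only [Fin.forall_fin_succ, Fin.lt_def, Matrix.cons_val_zero, Matrix.cons_val_succ,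
      Fin.succ_zero_eq_one, Fin.succ_one_eq_two, IsEmpty.forall_iff, and_true]
    omega

theorem pat2_31_eq_card {n : ℕ} (π : Equiv.Perm (Fin n)) :
    pat2_31 π = #{x ∈ range n ×ˢ range n | x.2 < x.1 ∧ x.1 < prev (extendPerm π) x.2 ∧
      (extendPerm π).symm x.1 < (extendPerm π).symm x.2} := by
  rw [pat2_31, patternCount_left _ (by decide) (by decide) (by decide)]
  congr 1
  ext ⟨z, y⟩
  have := (extendPerm π).symm.injective.eq_iff (a := z) (b := y)
  rw [mem_filter, mem_filter]
  simp only [Matrix.cons_val_zero, Matrix.cons_val_one, Matrix.cons_val]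
  refine and_congr_right fun _ => ?_
  omega

theorem pat31_2_eq_card {n : ℕ} (π : Equiv.Perm (Fin n)) :
    pat31_2 π = #{x ∈ range n ×ˢ range n | x.2 < x.1 ∧ x.1 < prev (extendPerm π) x.2 ∧
      (extendPerm π).symm x.2 < (extendPerm π).symm x.1} := by
  rw [pat31_2, patternCount_right _ (by decide) (by decide) (by decide)]
  congr 1
  ext ⟨z, y⟩
  have := (extendPerm π).symm.injective.eq_iff (a := z) (b := y)
  rw [mem_filter, mem_filter]
  simp only [Matrix.cons_val_zero, Matrix.cons_val_one, Matrix.cons_val]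
  refine and_congr_right fun _ => ?_
  omega

theorem pat1_32_eq_card {n : ℕ} (π : Equiv.Perm (Fin n)) :
    pat1_32 π = #{x ∈ range n ×ˢ range n | x.1 < x.2 ∧ x.2 < prev (extendPerm π) x.2 ∧
      (extendPerm π).symm x.1 < (extendPerm π).symm x.2} := by
  rw [pat1_32, patternCount_left _ (by decide) (by decide) (by decide)]
  congr 1
  ext ⟨z, y⟩
  have := (extendPerm π).symm.injective.eq_iff (a := z) (b := y)
  rw [mem_filter, mem_filter]
  simp only [Matrix.cons_val_zero, Matrix.cons_val_one, Matrix.cons_val]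
  refine and_congr_right fun _ => ?_
  omega

theorem pat32_1_eq_card {n : ℕ} (π : Equiv.Perm (Fin n)) :
    pat32_1 π = #{x ∈ range n ×ˢ range n | x.1 < x.2 ∧ x.2 < prev (extendPerm π) x.2 ∧
      (extendPerm π).symm x.2 < (extendPerm π).symm x.1} := by
  rw [pat32_1, patternCount_right _ (by decide) (by decide) (by decide)]
  congr 1
  ext ⟨z, y⟩
  have := (extendPerm π).symm.injective.eq_iff (a := z) (b := y)
  rw [mem_filter, mem_filter]
  simp only [Matrix.cons_val_zero, Matrix.cons_val_one, Matrix.cons_val]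
  refine and_congr_right fun _ => ?_
  omega

theorem pat3_21_eq_card {n : ℕ} (π : Equiv.Perm (Fin n)) :
    pat3_21 π = #{x ∈ range n ×ˢ range n | x.2 < prev (extendPerm π) x.2 ∧ prev (extendPerm π) x.2 < x.1 ∧
      (extendPerm π).symm x.1 < (extendPerm π).symm x.2} := by
  rw [pat3_21, patternCount_left _ (by decide) (by decide) (by decide)]
  congr 1
  ext ⟨z, y⟩
  have := (extendPerm π).symm.injective.eq_iff (a := z) (b := y)
  rw [mem_filter, mem_filter]
  simp only [Matrix.cons_val_zero, Matrix.cons_val_one, Matrix.cons_val]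
  refine and_congr_right fun _ => ?_
  omega

theorem pat21_3_eq_card {n : ℕ} (π : Equiv.Perm (Fin n)) :
    pat21_3 π = #{x ∈ range n ×ˢ range n | x.2 < prev (extendPerm π) x.2 ∧ prev (extendPerm π) x.2 < x.1 ∧
      (extendPerm π).symm x.2 < (extendPerm π).symm x.1} := by
  rw [pat21_3, patternCount_right _ (by decide) (by decide) (by decide)]
  congr 1
  ext ⟨z, y⟩
  have := (extendPerm π).symm.injective.eq_iff (a := z) (b := y)
  rw [mem_filter, mem_filter]
  simp only [Matrix.cons_val_zero, Matrix.cons_val_one, Matrix.cons_val]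
  refine and_congr_right fun _ => ?_
  omega

theorem weight_code (σ : Equiv.Perm ℕ) (n : ℕ) :
    weight (code σ n) = ∑ v ∈ range n, rightStraddles σ v := by
  induction n with
  | zero => rfl
  | succ n ih =>
    rw [sum_range_succ, ← ih, code, weight, List.map_cons, List.sum_cons, add_comm]
    rfl

theorem pat2_31_eq {n : ℕ} (π : Equiv.Perm (Fin n)) :
    pat2_31 π = weight (code (extendPerm π) n) := by
  rw [weight_code, pat2_31_eq_card, card_filter, sum_product]
  refine sum_congr rfl fun z hz => ?_
  rw [← card_filter, rightStraddles]
  congr 1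
  ext y
  rw [mem_range] at hz
  simp only [mem_filter, mem_range]
  omega

theorem pat1_32_add_pat32_1 {n : ℕ} (π : Equiv.Perm (Fin n)) :
    pat1_32 π + pat32_1 π =
      ∑ y ∈ range n, if isBot (extendPerm π) y then y else 0 := by
  rw [pat1_32_eq_card, pat32_1_eq_card, card_filter, card_filter,
    ← sum_add_distrib, sum_product_right]
  refine sum_congr rfl fun y hy => ?_
  trans #{z ∈ range n | z < y ∧ y < prev (extendPerm π) y}
  · rw [card_filter]
    refine sum_congr rfl fun z hz => ?_
    have := (extendPerm π).symm.injective.eq_iff (a := z) (b := y)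
    dsimp only
    split_ifs <;> omega
  · rw [mem_range] at hy
    by_cases h : y < prev (extendPerm π) y
    · rw [if_pos (by simpa [isBot] using h)]
      have : {z ∈ range n | z < y ∧ y < prev (extendPerm π) y} = range y := by
        ext z
        simp only [mem_filter, mem_range]
        omega
      rw [this, card_range]
    · rw [if_neg (by simpa [isBot] using h), card_eq_zero]
      simp [h]

/-- For a fixed descent, each of the other `n - 2` letters is below, between or above its two
letters, and to the left or right of them: exactly one of the six patterns. -/
theorem sum_patterns {n : ℕ} (π : Equiv.Perm (Fin n)) :
    pat31_2 π + pat21_3 π + pat3_21 π + pat2_31 π + (pat1_32 π + pat32_1 π) =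
      ∑ y ∈ range n, if isBot (extendPerm π) y then n - 2 else 0 := by
  rw [pat31_2_eq_card, pat21_3_eq_card, pat3_21_eq_card, pat2_31_eq_card, pat1_32_eq_card,
    pat32_1_eq_card]
  simp only [card_filter]
  simp only [← sum_add_distrib]
  rw [sum_product_right]
  refine sum_congr rfl fun y hy => ?_
  trans #{z ∈ range n | y < prev (extendPerm π) y ∧ z ≠ y ∧ z ≠ prev (extendPerm π) y}
  · rw [card_filter]
    refine sum_congr rfl fun z hz => ?_
    have := (extendPerm π).symm.injective.eq_iff (a := z) (b := y)
    dsimp only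
    split_ifs <;> omega
  · rw [mem_range] at hy
    by_cases h : y < prev (extendPerm π) y
    · rw [if_pos (by simpa [isBot] using h)]
      have : {z ∈ range n | y < prev (extendPerm π) y ∧ z ≠ y ∧ z ≠ prev (extendPerm π) y} =
          ((range n).erase y).erase (prev (extendPerm π) y) := by
        ext z
        simp only [mem_filter, mem_range, mem_erase]
        tauto
      have hp := prev_lt (extendPerm_of_le π) hy
      rw [this, card_erase_of_mem, card_erase_of_mem (mem_range.2 hy), card_range]
      · omega
      · exact mem_erase.2 ⟨h.ne', mem_range.2 hp⟩
    · rw [if_neg (by simpa [isBot] using h), card_eq_zero]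
      simp [h]

theorem des_eq {n : ℕ} (π : Equiv.Perm (Fin n)) :
    des π = #{y ∈ range n | isBot (extendPerm π) y} := by
  rw [des, ← Set.ncard_coe_finset]
  refine Set.ncard_congr (fun i _ => extendPerm π (i + 1)) ?_ ?_ ?_
  · rintro i ⟨h, hi⟩
    have e := extendPerm_apply π ⟨i + 1, h⟩
    simp only [coe_filter, mem_range, Set.mem_ofPred_eq, isBot, decide_eq_true_eq,
      prev_apply_succ, extendPerm_apply]
    rw [show extendPerm π (i + 1) = _ from e]
    exact ⟨Fin.is_lt _, hi⟩
  · intro i j _ _ h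
    exact Fin.ext (Nat.succ_injective ((extendPerm π).injective h))
  · intro y hy
    simp only [coe_filter, mem_range, Set.mem_ofPred_eq, isBot, decide_eq_true_eq] at hy
    obtain ⟨i, j, hij, rfl, hi⟩ := exists_pred_of_lt_prev π hy.1 hy.2
    refine ⟨i, ⟨by omega, ?_⟩, ?_⟩
    · rw [show (⟨(i : ℕ) + 1, _⟩ : Fin n) = j from Fin.ext hij.symm, Fin.lt_def, hi]
      exact hy.2
    · rw [← hij, extendPerm_apply]

theorem card_isBot (σ : Equiv.Perm ℕ) (n : ℕ) :
    #{y ∈ range n | isBot σ y} = (word σ n).count true := by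
  induction n with
  | zero => rfl
  | succ n ih =>
    rw [range_add_one, filter_insert, word]
    cases h : isBot σ n
    · simpa using ih
    · rw [if_pos rfl, card_insert_of_notMem (by simp), ih, List.count_cons_self]

/-- A descent bottom `y` has `y` smaller letters: those that are not descent bottoms contribute to
`twos`, and the pairs of descent bottoms give the binomial coefficient. -/
theorem sum_isBot (σ : Equiv.Perm ℕ) (n : ℕ) :
    (∑ y ∈ range n, if isBot σ y then y else 0) =
      twos (word σ n) + ((word σ n).count true).choose 2 := by
  induction n with
  | zero => rfl
  | succ n ih =>
    rw [sum_range_succ, ih, word]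
    cases h : isBot σ n
    · simp [twos]
    · have hl := length_word σ n
      rw [← List.count_true_add_count_false] at hl
      rw [if_pos rfl, twos, List.count_cons_self, Nat.choose_succ_succ' _ 1,
        Nat.choose_one_right]
      simp only [Nat.reduceAdd]
      omega

/-- The largest letter is never a descent bottom, so a path of length `n` carries all the
information. -/
theorem word_succ {n : ℕ} (π : Equiv.Perm (Fin (n + 1))) :
    word (extendPerm π) (n + 1) = false :: word (extendPerm π) n := by
  have := prev_lt (extendPerm_of_le π) (Nat.lt_succ_self n)
  rw [word, show isBot (extendPerm π) n = false by simp [isBot]; omega]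

/-- Given the conditions on `des`, `b` and `c`, the condition on `a` is equivalent to the total `a +
b + c`, since the sum of the six pattern counts depends only on `des`. -/
theorem mem_patternPermutations {N K a b c : ℕ} (hK : K ≤ N) (π : Equiv.Perm (Fin (N + 1))) :
    π ∈ patternPermutations (N + 1) (K + 1) a b c ↔
      (word (extendPerm π) N).count true = K ∧ twos (word (extendPerm π) N) = c ∧
      weight (code (extendPerm π) (N + 1)) + (N - K) = b ∧
      a + b + c = (K + 1) * (N - K) := by
  have h1 : des π = (word (extendPerm π) N).count true := by
    rw [des_eq, card_isBot, word_succ]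
    simp
  have h2 := pat2_31_eq π
  have h3 : pat1_32 π + pat32_1 π = twos (word (extendPerm π) N) + (des π).choose 2 := by
    rw [pat1_32_add_pat32_1, sum_isBot, word_succ, h1]
    simp [twos]
  have h4 : pat31_2 π + pat21_3 π + pat3_21 π + pat2_31 π + (pat1_32 π + pat32_1 π) +
      2 * des π = des π * (N + 1) := by
    rw [sum_patterns, ← sum_filter, sum_const, ← des_eq, smul_eq_mul]
    -- For a single letter `n - 2` is truncated, but then there is no descent.
    rcases N with _ | N
    · have : (word (extendPerm π) 0).count true = 0 := rfl
      simp [h1, this]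
    · simp
      ring
  have h5 : (2 : ℤ) * (des π).choose 2 = des π * (des π - 1) := by
    have := Nat.cast_choose_two ℚ (des π)
    have h : (2 : ℚ) * (des π).choose 2 = des π * (des π - 1) := by
      rw [this]
      ring
    exact_mod_cast h
  rw [← h1, ← h2]
  simp only [patternPermutations, Set.mem_ofPred_eq]
  obtain ⟨M, rfl⟩ := Nat.exists_eq_add_of_le hK
  rw [Nat.add_sub_cancel_left]
  generalize des π = d at *
  clear h1 h2
  zify at h3 h4
  constructor
  · rintro ⟨e1, e2, e3, e4⟩
    obtain rfl : d = K := by omega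
    push_cast at e1 e2 e3 e4
    refine ⟨rfl, by omega, by omega, ?_⟩
    zify
    linarith
  · rintro ⟨rfl, e2, e3, e4⟩
    zify at e2 e3 e4
    push_cast
    refine ⟨by ring, by linarith, by linarith, by linarith⟩

/-! ### Tableaux as lattice paths with fillings -/

/-- The canonical labelling of the steps of a lattice path by row and column indices. -/
def label : List Bool → List (Bool × ℕ)
  | [] => []
  | true :: w => (true, w.count true + 1) :: label w
  | false :: w => (false, w.count false) :: label w

/-- The row lengths of the diagram below a lattice path. -/
def rowLength : List Bool → ℕ → ℕ
  | [], _ => 0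
  | true :: w, i => rowLength w i
  | false :: w, i => if i ≤ w.count true then rowLength w i + 1 else 0

theorem map_fst_label (w : List Bool) : (label w).map Prod.fst = w := by
  induction w with
  | nil => rfl
  | cons x w ih => cases x <;> simp [label, ih]

theorem rows_label (w : List Bool) : rows (label w) = range (w.count true + 1) := by
  induction w with
  | nil => rfl
  | cons x w ih =>
    cases x
    · simpa [label, rows] using ih
    · rw [label, rows, ih, List.count_cons_self, range_add_one (n := w.count true + 1)]

theorem cols_label (w : List Bool) : cols (label w) = range (w.count false) := by
  induction w with
  | nil => rfl
  | cons x w ih =>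
    cases x
    · rw [label, cols, ih, List.count_cons_self, range_add_one]
    · simpa [label, cols] using ih

theorem wellLabelled_label (w : List Bool) : WellLabelled (label w) := by
  induction w with
  | nil => trivial
  | cons x w ih =>
    cases x
    · refine ⟨ih, fun j hj => ?_⟩
      rwa [cols_label, mem_range] at hj
    · refine ⟨ih, fun j hj => ?_⟩
      rwa [rows_label, mem_range] at hj

/-- A row and a column of the rectangle fail to meet exactly when the column was created before the
row, which is a pair counted by `twos`. -/
theorem card_boxes_label (w : List Bool) :
    #(boxes (label w)) + twos w = (w.count true + 1) * w.count false := by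
  induction w with
  | nil => rfl
  | cons x w ih =>
    cases x
    · rw [label, boxes, card_union_of_disjoint, card_product, card_singleton, rows_label,
        card_range, twos, List.count_cons_self, List.count_cons_of_ne (by decide)]
      · linarith
      · rw [Finset.disjoint_left]
        intro x hx hx'
        have h1 := (mem_boxes hx).2
        rw [cols_label, mem_range] at h1
        rw [mem_product, mem_singleton] at hx'
        omega
    · rw [label, boxes, twos, List.count_cons_self, List.count_cons_of_ne (by decide)]
      linarith

theorem rowLength_of_lt {w : List Bool} {i : ℕ} (h : w.count true < i) : rowLength w i = 0 := by
  induction w with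
  | nil => rfl
  | cons x w ih =>
    cases x
    · rw [List.count_cons_of_ne (by decide)] at h
      rw [rowLength, if_neg (by omega)]
    · rw [List.count_cons_self] at h
      exact ih (by omega)

theorem rowLength_zero (w : List Bool) : rowLength w 0 = w.count false := by
  induction w with
  | nil => rfl
  | cons x w ih => cases x <;> simp [rowLength, ih]

theorem rowLength_antitone (w : List Bool) : Antitone (rowLength w) := by
  induction w with
  | nil => exact antitone_const
  | cons x w ih =>
    cases x
    · intro i j h
      have := ih h
      simp only [rowLength]
      split_ifs <;> omega
    · exact ih

theorem mem_boxes_label {w : List Bool} {i j : ℕ} :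
    (i, j) ∈ boxes (label w) ↔ j < w.count false ∧ w.count false ≤ j + rowLength w i := by
  induction w with
  | nil => simp [label, boxes]
  | cons x w ih =>
    cases x
    · rw [label, boxes, mem_union, ih, rows_label, mem_product, mem_range, mem_singleton,
        List.count_cons_self, rowLength]
      split_ifs with h
      · omega
      · rw [rowLength_of_lt (by omega)]
        omega
    · rw [label, boxes, ih, List.count_cons_of_ne (by decide), rowLength]

theorem eq_of_rowLength_eq {w w' : List Bool} (hc : w.count true = w'.count true)
    (h : rowLength w = rowLength w') : w = w' := by
  have hf : w.count false = w'.count false := by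
    rw [← rowLength_zero, ← rowLength_zero, h]
  induction w generalizing w' with
  | nil =>
    have := List.count_true_add_count_false w'
    rw [← hc, ← hf] at this
    exact (List.length_eq_zero_iff.1 this.symm).symm
  | cons x w ih =>
    rcases w' with _ | ⟨y, w'⟩
    · cases x <;> simp at hc hf
    · have h1 := fun i => congrFun h i
      cases x <;> cases y <;> simp only [rowLength] at h1
      · simp only [List.count_cons_self, List.count_cons_of_ne (show false ≠ true by decide),
          Nat.add_right_cancel_iff] at hc hf
        rw [ih hc _ hf]
        funext i
        have := h1 i
        rw [hc] at this
        split_ifs at this with hi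
        · omega
        · rw [rowLength_of_lt (by omega), rowLength_of_lt (by omega)]
      -- The lowest row of the rectangle distinguishes the paths: it is nonempty if the last step is
      -- a column and empty if the last step is a row.
      · have := h1 (w.count true)
        simp only [List.count_cons_self, List.count_cons_of_ne (show false ≠ true by decide)] at hc
        rw [if_pos le_rfl, rowLength_of_lt (w := w') (by omega)] at this
        omega
      · have := h1 (w'.count true)
        simp only [List.count_cons_self, List.count_cons_of_ne (show false ≠ true by decide)] at hc
        rw [if_pos le_rfl, rowLength_of_lt (w := w) (by omega)] at this
        omega
      · simp only [List.count_cons_self, List.count_cons_of_ne (show true ≠ false by decide),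
          Nat.add_right_cancel_iff] at hc hf
        rw [ih hc (funext h1) hf]

/-- The last step is read off the lowest row `K`: if it is empty and `K` is positive, remove that
row; otherwise remove the leftmost column, which meets all rows. -/
theorem exists_rowLength_eq (m K : ℕ) (f : ℕ → ℕ) (hf : Antitone f) (h0 : f 0 = m)
    (hK : ∀ i, K < i → f i = 0) :
    ∃ w : List Bool, w.count true = K ∧ w.count false = m ∧ rowLength w = f := by
  induction m generalizing K f with
  | zero =>
    refine ⟨List.replicate K true, by simp, by simp [List.count_replicate], ?_⟩
    funext i
    have h1 : f i = 0 := Nat.le_zero.1 (h0 ▸ hf (Nat.zero_le i))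
    have h2 := rowLength_antitone (List.replicate K true) (Nat.zero_le i)
    rw [rowLength_zero] at h2
    simp [List.count_replicate] at h2
    omega
  | succ m ihm =>
    induction K with
    | zero =>
      obtain ⟨w, h1, h2, h3⟩ := ihm 0 (fun i => f i - 1) (fun i j h => Nat.sub_le_sub_right (hf h) 1)
        (by simp [h0]) (fun i hi => by simp [hK i hi])
      refine ⟨false :: w, by simpa using h1, by simpa using h2, ?_⟩
      funext i
      rw [rowLength, h1, h3]
      split_ifs with hi
      · obtain rfl : i = 0 := by omega
        simp only [h0, Nat.add_sub_cancel]
      · exact (hK i (by omega)).symm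
    | succ K ihK =>
      by_cases hz : f (K + 1) = 0
      · obtain ⟨w, h1, h2, h3⟩ := ihK fun i hi => Nat.le_zero.1 (hz ▸ hf (Nat.succ_le_of_lt hi))
        exact ⟨true :: w, by simpa using h1, by simpa using h2, by
          funext i
          rw [rowLength, h3]⟩
      · obtain ⟨w, h1, h2, h3⟩ := ihm (K + 1) (fun i => f i - 1)
          (fun i j h => Nat.sub_le_sub_right (hf h) 1) (by simp [h0])
          (fun i hi => by simp [hK i hi])
        refine ⟨false :: w, by simpa using h1, by simpa using h2, ?_⟩
        funext i
        rw [rowLength, h1, h3]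
        split_ifs with hi
        · have := hf hi
          exact Nat.sub_add_cancel (by omega)
        · exact (hK i (by omega)).symm

/-- The array with entry `1` at the boxes in `O`, entry `0` at the other boxes of `B`, and entry
`2` elsewhere. -/
def toMatrix (k m : ℕ) (B O : Finset (ℕ × ℕ)) : Matrix (Fin k) (Fin m) (Fin 3) := fun i j =>
  if ((i : ℕ), (j.rev : ℕ)) ∈ O then 1 else if ((i : ℕ), (j.rev : ℕ)) ∈ B then 0 else 2

section ToMatrix

variable {k m : ℕ} {B O : Finset (ℕ × ℕ)}

theorem toMatrix_eq_one {i : Fin k} {j : Fin m} :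
    toMatrix k m B O i j = 1 ↔ ((i : ℕ), (j.rev : ℕ)) ∈ O := by
  unfold toMatrix
  split_ifs <;> simp_all

theorem toMatrix_eq_zero {i : Fin k} {j : Fin m} :
    toMatrix k m B O i j = 0 ↔ ((i : ℕ), (j.rev : ℕ)) ∈ B \ O := by
  rw [mem_sdiff]
  unfold toMatrix
  split_ifs <;> simp_all

theorem toMatrix_eq_two (h : O ⊆ B) {i : Fin k} {j : Fin m} :
    toMatrix k m B O i j = 2 ↔ ((i : ℕ), (j.rev : ℕ)) ∉ B := by
  unfold toMatrix
  split_ifs with h1 h2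
  · exact iff_of_false (by decide) (not_not.2 (h h1))
  · exact iff_of_false (by decide) (not_not.2 h2)
  · exact iff_of_true rfl h2

theorem ncard_rev_mem {A : Finset (ℕ × ℕ)} (hA : A ⊆ range k ×ˢ range m) :
    {x : Fin k × Fin m | ((x.1 : ℕ), (x.2.rev : ℕ)) ∈ A}.ncard = #A := by
  rw [← Set.ncard_coe_finset]
  refine Set.ncard_congr (fun x _ => ((x.1 : ℕ), (x.2.rev : ℕ))) (fun x hx => hx) ?_ ?_
  · rintro ⟨i, j⟩ ⟨i', j'⟩ - - h
    simp only [Prod.mk.injEq] at h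
    exact Prod.ext (Fin.ext h.1) (Fin.rev_injective (Fin.ext h.2))
  · rintro ⟨i, j⟩ hx
    have h := hA hx
    rw [mem_product, mem_range, mem_range] at h
    exact ⟨(⟨i, h.1⟩, (⟨j, h.2⟩ : Fin m).rev), by simpa only [Set.mem_ofPred_eq, Fin.rev_rev, mem_coe] using hx,
      by simp only [Fin.rev_rev]⟩

theorem entryCount_toMatrix_one (hO : O ⊆ B) (hB : B ⊆ range k ×ˢ range m) :
    entryCount (toMatrix k m B O) 1 = #O := by
  simp only [entryCount, toMatrix_eq_one]
  exact ncard_rev_mem (hO.trans hB)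

theorem entryCount_toMatrix_zero (hO : O ⊆ B) (hB : B ⊆ range k ×ˢ range m) :
    entryCount (toMatrix k m B O) 0 + #O = #B := by
  simp only [entryCount, toMatrix_eq_zero]
  rw [ncard_rev_mem (sdiff_subset.trans hB), card_sdiff_add_card_eq_card hO]

theorem entryCount_toMatrix_two (hO : O ⊆ B) (hB : B ⊆ range k ×ˢ range m) :
    entryCount (toMatrix k m B O) 2 + #B = k * m := by
  have : {x : Fin k × Fin m | toMatrix k m B O x.1 x.2 = 2} =
      {x | ((x.1 : ℕ), (x.2.rev : ℕ)) ∈ (range k ×ˢ range m) \ B} := by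
    ext x
    simp only [toMatrix_eq_two hO, Set.mem_ofPred_eq, mem_sdiff, mem_product, mem_range,
      Fin.is_lt, true_and]
  rw [entryCount, this, ncard_rev_mem sdiff_subset, card_sdiff_add_card_eq_card hB,
    card_product, card_range, card_range]

end ToMatrix

theorem boxes_label_subset (w : List Bool) :
    boxes (label w) ⊆ range (w.count true + 1) ×ˢ range (w.count false) := by
  intro x hx
  rw [mem_product, ← rows_label, ← cols_label]
  exact mem_boxes hx

theorem toMatrix_ne_two_iff {w : List Bool} {O : Finset (ℕ × ℕ)} (hO : O ⊆ boxes (label w))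
    {k : ℕ} (i : Fin k) (j : Fin (w.count false)) :
    toMatrix k (w.count false) (boxes (label w)) O i j ≠ 2 ↔ (j : ℕ) < rowLength w i := by
  rw [ne_eq, toMatrix_eq_two hO, not_not, mem_boxes_label, Fin.val_rev]
  omega

theorem isPermutationTableau_toMatrix {w : List Bool} {O : Finset (ℕ × ℕ)}
    (hO : IsFilling (range (w.count false)) (boxes (label w)) O) :
    IsPermutationTableau
      (toMatrix (w.count true + 1) (w.count false) (boxes (label w)) O) where
  exists_shape := by
    refine ⟨fun i => rowLength w i, fun i j h => rowLength_antitone w h, fun i => ?_,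
      toMatrix_ne_two_iff hO.1⟩
    rw [← rowLength_zero]
    exact rowLength_antitone w (Nat.zero_le _)
  exists_one j := by
    obtain ⟨i, hi⟩ := hO.2.1 j.rev (mem_range.2 (Fin.is_lt _))
    have := boxes_label_subset w (hO.1 hi)
    rw [mem_product, mem_range] at this
    exact ⟨⟨i, this.1⟩, toMatrix_eq_one.2 hi⟩
  zero_cond i j h := by
    rintro ⟨⟨i', hi, h1⟩, j', hj, h2⟩
    rw [toMatrix_eq_zero, mem_sdiff] at h
    rw [toMatrix_eq_one] at h1 h2
    exact h.2 (hO.2.2 _ _ _ _ h.1 hi h1 (Fin.rev_lt_rev.2 hj) h2)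

theorem toMatrix_injective {w w' : List Bool} {O O' : Finset (ℕ × ℕ)} {k m : ℕ}
    (ht : w.count true + 1 = k) (hf : w.count false = m) (ht' : w'.count true + 1 = k)
    (hf' : w'.count false = m) (hO : O ⊆ boxes (label w)) (hO' : O' ⊆ boxes (label w'))
    (h : toMatrix k m (boxes (label w)) O = toMatrix k m (boxes (label w')) O') :
    w = w' ∧ O = O' := by
  have hB := boxes_label_subset w
  have hB' := boxes_label_subset w'
  rw [ht, hf] at hB
  rw [ht', hf'] at hB'
  have key : ∀ i < k, ∀ j < m, ((i, j) ∈ O ↔ (i, j) ∈ O') ∧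
      ((i, j) ∈ boxes (label w) ↔ (i, j) ∈ boxes (label w')) := by
    intro i hi j hj
    have e := congrFun (congrFun h ⟨i, hi⟩) (Fin.rev ⟨j, hj⟩)
    constructor
    · have h1 := toMatrix_eq_one (B := boxes (label w)) (O := O) (i := ⟨i, hi⟩)
        (j := Fin.rev ⟨j, hj⟩)
      have h2 := toMatrix_eq_one (B := boxes (label w')) (O := O') (i := ⟨i, hi⟩)
        (j := Fin.rev ⟨j, hj⟩)
      rw [e, h2] at h1
      simpa using h1.symm
    · have h1 := toMatrix_eq_two hO (i := ⟨i, hi⟩) (j := Fin.rev ⟨j, hj⟩)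
      have h2 := toMatrix_eq_two hO' (i := ⟨i, hi⟩) (j := Fin.rev ⟨j, hj⟩)
      rw [e, h2, not_iff_not] at h1
      simpa using h1.symm
  constructor
  · refine eq_of_rowLength_eq (by omega) (funext fun i => ?_)
    by_cases hi : i < k
    · have h1 := rowLength_antitone w (Nat.zero_le i)
      have h2 := rowLength_antitone w' (Nat.zero_le i)
      rw [rowLength_zero] at h1 h2
      have h3 := fun j hj => (key i hi j hj).2
      simp only [mem_boxes_label] at h3
      -- Since columns are numbered from the right, this index is the rightmost box of row `i`;
      -- comparing the shapes there and at its counterpart for `w'` forces equal lengths.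
      have h4 := h3 (m - rowLength w i)
      have h5 := h3 (m - rowLength w' i)
      omega
    · rw [rowLength_of_lt (by omega), rowLength_of_lt (by omega)]
  · ext ⟨i, j⟩
    constructor
    · intro hm
      have := hB (hO hm)
      rw [mem_product, mem_range, mem_range] at this
      exact (key i this.1 j this.2).1.1 hm
    · intro hm
      have := hB' (hO' hm)
      rw [mem_product, mem_range, mem_range] at this
      exact (key i this.1 j this.2).1.2 hm

theorem exists_toMatrix_eq {K m : ℕ} {T : Matrix (Fin (K + 1)) (Fin m) (Fin 3)}
    (hT : IsPermutationTableau T) :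
    ∃ w O, w.count true = K ∧ w.count false = m ∧ IsFilling (range m) (boxes (label w)) O ∧
      toMatrix (K + 1) m (boxes (label w)) O = T := by
  obtain ⟨lam, hanti, hle, hlam⟩ := hT.exists_shape
  -- The rightmost column contains a `1`, so some row has full length, hence so does row 0.
  have h0 : lam 0 = m := by
    refine le_antisymm (hle 0) ?_
    by_contra hlt
    have hm : m - 1 < m := by omega
    obtain ⟨i, hi⟩ := hT.exists_one ⟨m - 1, hm⟩
    have h1 := (hlam i ⟨m - 1, hm⟩).1 (by simp [hi])
    have h2 := hanti (Fin.zero_le i)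
    simp only at h1
    omega
  obtain ⟨w, h1, h2, h3⟩ := exists_rowLength_eq m K
    (fun i => if h : i < K + 1 then lam ⟨i, h⟩ else 0)
    (by
      intro i j h
      by_cases hj : j < K + 1
      · have hi : i < K + 1 := by omega
        simpa [hi, hj] using hanti (show (⟨i, hi⟩ : Fin (K + 1)) ≤ ⟨j, hj⟩ from h)
      · simp [hj])
    (by simpa using h0) (fun i hi => dif_neg (by omega))
  have hrow : ∀ i : Fin (K + 1), rowLength w i = lam i := fun i => by
    rw [h3]
    exact dif_pos i.is_lt
  have hbox : ∀ (i : Fin (K + 1)) (j : Fin m),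
      ((i : ℕ), (j.rev : ℕ)) ∈ boxes (label w) ↔ T i j ≠ 2 := by
    intro i j
    rw [mem_boxes_label, hrow, h2, hlam, Fin.val_rev]
    omega
  let O : Finset (ℕ × ℕ) := ({x : Fin (K + 1) × Fin m | T x.1 x.2 = 1} : Finset _).image
    fun x => ((x.1 : ℕ), (x.2.rev : ℕ))
  have hO : ∀ (i : Fin (K + 1)) (j : Fin m), ((i : ℕ), (j.rev : ℕ)) ∈ O ↔ T i j = 1 := by
    intro i j
    simp only [O, mem_image, mem_filter, mem_univ, true_and, Prod.mk.injEq, Prod.exists]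
    constructor
    · rintro ⟨i', j', h, hi, hj⟩
      rwa [← Fin.ext hi, ← Fin.rev_injective (Fin.ext hj)]
    · exact fun h => ⟨i, j, h, rfl, rfl⟩
  have hex : ∀ x ∈ O, ∃ (i : Fin (K + 1)) (j : Fin m), x = ((i : ℕ), (j.rev : ℕ)) := by
    intro x hx
    obtain ⟨⟨i, j⟩, -, rfl⟩ := mem_image.1 hx
    exact ⟨i, j, rfl⟩
  have hsub : O ⊆ boxes (label w) := by
    intro x hx
    obtain ⟨i, j, rfl⟩ := hex x hx
    rw [hbox, (hO i j).1 hx]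
    decide
  refine ⟨w, O, h1, h2, ⟨hsub, ?_, ?_⟩, ?_⟩
  · intro j hj
    rw [mem_range] at hj
    obtain ⟨i, hi⟩ := hT.exists_one (Fin.rev ⟨j, hj⟩)
    refine ⟨i, ?_⟩
    simpa using (hO i (Fin.rev ⟨j, hj⟩)).2 hi
  · intro i j i' j' hb hi ho hj ho'
    obtain ⟨a', b, e1⟩ := hex _ ho
    obtain ⟨a, b', e2⟩ := hex _ ho'
    simp only [Prod.mk.injEq] at e1 e2
    obtain ⟨rfl, rfl⟩ := e1
    obtain ⟨rfl, rfl⟩ := e2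
    rw [hO] at ho ho' ⊢
    rw [hbox] at hb
    have hz : T a b ≠ 0 := fun hz =>
      hT.zero_cond a b hz ⟨⟨a', hi, ho⟩, b', Fin.rev_lt_rev.1 hj, ho'⟩
    revert hb hz
    generalize T a b = e
    revert e
    decide
  · ext i j
    have e1 := hO i j
    have e2 := hbox i j
    unfold toMatrix
    simp only [e1, e2]
    generalize T i j = e
    revert e
    decide

/-! ### Comparison of the two counts -/

theorem coeff_fillingGF (C : Finset ℕ) (B : Finset (ℕ × ℕ)) (b : ℕ) :
    (fillingGF C B).coeff b = #{O ∈ fillings C B | #O = b} := by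
  simp only [fillingGF, finsetSum_coeff, coeff_X_pow, card_filter, eq_comm (a := b)]

/-- Compare coefficients in `fillingGF_boxes`: `wordGF w` counts histories ending with one more
`false`, the step of the largest letter, and these are permutations of `N + 1` letters. -/
theorem card_fillings_eq_card_perm {N m : ℕ} {w : List Bool} (hw : w.length = N)
    (hm : w.count false = m) (b : ℕ) :
    #{O ∈ fillings (range m) (boxes (label w)) | #O = b} =
      #{π : Equiv.Perm (Fin (N + 1)) | word (extendPerm π) N = w ∧
        weight (code (extendPerm π) (N + 1)) + m = b} := by
  have h := fillingGF_boxes (label w) (wellLabelled_label w)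
  rw [map_fst_label, cols_label, hm, ← histGF_false_zero,
    ← sum_perm_word_eq (n := N + 1) (by simp [hw]), mul_sum] at h
  rw [← coeff_fillingGF, h]
  simp only [← pow_add, finsetSum_coeff, coeff_X_pow, word_succ, List.cons.injEq, true_and]
  rw [← card_filter, filter_filter]
  congr 1
  ext π
  simp only [mem_filter, mem_univ, true_and]
  refine and_congr_right fun _ => ?_
  omega

/-- The pairs of a shape and a filling that correspond to the permutation tableaux with `K + 1`
rows, `m` columns, `b` entries `1` and `c` entries `2`. -/
noncomputable def shapedFillings (K m b c : ℕ) : Finset (Σ _ : List Bool, Finset (ℕ × ℕ)) :=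
  {w ∈ words (K + m) | w.count true = K ∧ twos w = c}.sigma fun w =>
    {O ∈ fillings (range m) (boxes (label w)) | #O = b}

theorem mem_shapedFillings {K m b c : ℕ} {w : List Bool} {O : Finset (ℕ × ℕ)} :
    ⟨w, O⟩ ∈ shapedFillings K m b c ↔ w.count true = K ∧ w.count false = m ∧ twos w = c ∧
      IsFilling (range m) (boxes (label w)) O ∧ #O = b := by
  have := List.count_true_add_count_false w
  simp only [shapedFillings, mem_sigma, mem_filter, mem_words, mem_fillings]
  constructor
  · rintro ⟨⟨h1, h2, h3⟩, h4, h5⟩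
    exact ⟨h2, by omega, h3, h4, h5⟩
  · rintro ⟨h1, h2, h3, h4, h5⟩
    exact ⟨⟨by omega, h1, h3⟩, h4, h5⟩

theorem entryCount_toMatrix_label {w : List Bool} {O : Finset (ℕ × ℕ)} {K m : ℕ}
    (h1 : w.count true = K) (h2 : w.count false = m) (hO : O ⊆ boxes (label w)) :
    entryCount (toMatrix (K + 1) m (boxes (label w)) O) 1 = #O ∧
      entryCount (toMatrix (K + 1) m (boxes (label w)) O) 2 = twos w ∧
      entryCount (toMatrix (K + 1) m (boxes (label w)) O) 0 + #O + twos w = (K + 1) * m := by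
  have hB := boxes_label_subset w
  have hc := card_boxes_label w
  rw [h1, h2] at hB hc
  have e0 := entryCount_toMatrix_zero hO hB
  have e1 := entryCount_toMatrix_one hO hB
  have e2 := entryCount_toMatrix_two hO hB
  refine ⟨e1, by omega, by omega⟩

theorem ncard_permutationTableaux {K m a b c : ℕ} (h : a + b + c = (K + 1) * m) :
    (permutationTableaux (K + 1) m a b c).ncard = #(shapedFillings K m b c) := by
  rw [← Set.ncard_coe_finset]
  symm
  refine Set.ncard_congr (fun x _ => toMatrix (K + 1) m (boxes (label x.1)) x.2) ?_ ?_ ?_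
  · rintro ⟨w, O⟩ hx
    obtain ⟨rfl, rfl, h3, h4, h5⟩ := mem_shapedFillings.1 hx
    obtain ⟨e1, e2, e0⟩ := entryCount_toMatrix_label rfl rfl h4.1
    exact ⟨isPermutationTableau_toMatrix h4, by simp only; omega, by simp only; omega,
      by simp only; omega⟩
  · rintro ⟨w, O⟩ ⟨w', O'⟩ hx hx' he
    obtain ⟨h1, h2, -, h4, -⟩ := mem_shapedFillings.1 hx
    obtain ⟨h1', h2', -, h4', -⟩ := mem_shapedFillings.1 hx'
    obtain ⟨rfl, rfl⟩ := toMatrix_injective (by rw [h1]) h2 (by rw [h1']) h2' h4.1 h4'.1 he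
    rfl
  · rintro T ⟨hT, h0, h1, h2⟩
    obtain ⟨w, O, hw1, hw2, hO, rfl⟩ := exists_toMatrix_eq hT
    obtain ⟨e1, e2, -⟩ := entryCount_toMatrix_label hw1 hw2 hO.1
    exact ⟨⟨w, O⟩, mem_shapedFillings.2 ⟨hw1, hw2, by omega, hO, by omega⟩, rfl⟩

theorem permutationTableaux_eq_empty {K m a b c : ℕ} (h : a + b + c ≠ (K + 1) * m) :
    permutationTableaux (K + 1) m a b c = ∅ := by
  refine Set.eq_empty_of_forall_notMem ?_
  rintro T ⟨hT, h0, h1, h2⟩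
  obtain ⟨w, O, hw1, hw2, hO, rfl⟩ := exists_toMatrix_eq hT
  obtain ⟨e1, e2, e0⟩ := entryCount_toMatrix_label hw1 hw2 hO.1
  omega

theorem ncard_patternPermutations {K m a b c : ℕ} (h : a + b + c = (K + 1) * m) :
    (patternPermutations (K + m + 1) (K + 1) a b c).ncard = #(shapedFillings K m b c) := by
  have : patternPermutations (K + m + 1) (K + 1) a b c =
      (({π | ((word (extendPerm π) (K + m)).count true = K ∧
        twos (word (extendPerm π) (K + m)) = c) ∧
        weight (code (extendPerm π) (K + m + 1)) + m = b} :
        Finset (Equiv.Perm (Fin (K + m + 1)))) : Set _) := by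
    ext π
    rw [mem_patternPermutations (Nat.le_add_right K m), Nat.add_sub_cancel_left]
    simp only [coe_filter, mem_univ, true_and, Set.mem_ofPred_eq]
    tauto
  rw [this, Set.ncard_coe_finset, shapedFillings, card_sigma,
    card_eq_sum_card_fiberwise (f := fun π => word (extendPerm π) (K + m))
      (t := {w ∈ words (K + m) | w.count true = K ∧ twos w = c})]
  · refine sum_congr rfl fun w hw => ?_
    rw [mem_filter, mem_words] at hw
    have := List.count_true_add_count_false w
    rw [card_fillings_eq_card_perm hw.1 (by omega), filter_filter]
    congr 1
    ext π
    simp only [mem_filter, mem_univ, true_and]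
    constructor
    · rintro ⟨⟨-, h2⟩, h3⟩
      exact ⟨h3, h2⟩
    · rintro ⟨rfl, h2⟩
      exact ⟨⟨hw.2, h2⟩, rfl⟩
  · intro π hπ
    simp only [coe_filter, mem_univ, true_and, Set.mem_ofPred_eq, mem_words] at hπ ⊢
    exact ⟨length_word _ _, hπ.1⟩

theorem patternPermutations_eq_empty {K m a b c : ℕ} (h : a + b + c ≠ (K + 1) * m) :
    patternPermutations (K + m + 1) (K + 1) a b c = ∅ := by
  refine Set.eq_empty_of_forall_notMem fun π hπ => h ?_
  rw [mem_patternPermutations (Nat.le_add_right K m), Nat.add_sub_cancel_left] at hπ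
  exact hπ.2.2.2

end PermutationTableau

open PermutationTableau in
theorem mainTheorem5 (n k a b c : ℕ) (hn : 1 ≤ n) (hk : k ≤ n) :
    (permutationTableaux k (n - k) a b c).ncard = (patternPermutations n k a b c).ncard := by
  rcases k with _ | K
  -- With no rows there are still `n ≥ 1` columns, none of which can contain a `1`; on the other
  -- side `des` would be `-1`.
  · have h1 : permutationTableaux 0 (n - 0) a b c = ∅ := by
      refine Set.eq_empty_of_forall_notMem ?_
      rintro T ⟨hT, -⟩
      obtain ⟨i, -⟩ := hT.exists_one ⟨0, hn⟩
      exact i.elim0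
    have h2 : patternPermutations n 0 a b c = ∅ := by
      refine Set.eq_empty_of_forall_notMem ?_
      rintro π ⟨h, -⟩
      omega
    rw [h1, h2, Set.ncard_empty, Set.ncard_empty]
  · obtain ⟨m, rfl⟩ := Nat.exists_eq_add_of_le hk
    rw [Nat.add_sub_cancel_left, Nat.add_right_comm K 1 m]
    by_cases h : a + b + c = (K + 1) * m
    · rw [ncard_permutationTableaux h, ncard_patternPermutations h]
    · rw [permutationTableaux_eq_empty h, patternPermutations_eq_empty h, Set.ncard_empty,
        Set.ncard_empty]
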